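/- Let $H\in(0,1)$ and let $L=(L_t)_{t\in\mathbb R}$ be a two-sided L\'evy process, i.e. $L_t=L^{(1)}_t$ for $t\ge 0$ and $L_t=-L^{(2)}_{(-t)-}$ for $t<0$, with $L^{(1)},L^{(2)}$ independent and identically distributed real L\'evy processes, and assume $\mathbb E L_1=0$, $\mathbb E L_1^2<\infty$. For a deterministic $g\in L^2(\mathbb R)$, $\int g\,dL$ denotes the $L^2(\mathbb P)$-limit of the elementary integrals of step functions converging to $g$ in $L^2(\mathbb R)$. Let $$f_H(t,u)=C_H\left((t-u)_+^{H-\frac12}-(-u)_+^{H-\frac12}\right),\qquad C_H=\left(\int_0^\infty\left((1+u)^{H-\frac12}-u^{H-\frac12}\right)^2du+\frac1{2H}\right)^{-\frac12}$$ be the Mandelbrot--Van Ness kernel (with $x_+^p=x^p$ for $x>0$ and $x_+^p=0$ for $x\le 0$), and let $$z_H(t,u)=c_H(t-u)^{H-\frac12}F\left(\tfrac12-H,H-\tfrac12,H+\tfrac12,\tfrac{u-t}{u}\right)\ (0<u<t),\qquad c_H=\frac1{\Gamma(H+\frac12)}\left(\frac{2H\,\Gamma(H+\frac12)\Gamma(\frac32-H)}{\Gamma(2-2H)}\right)^{\frac12},$$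 $z_H(t,u)=0$ otherwise, be the Molchan--Golosov kernel, where $F$ is Gauss' hypergeometric function (the power series on $(-1,1)$, continued analytically to $(-\infty,1)$). For $s>0$ put $$Y^s_t=\int_0^t z_H(t,u)\,dL_{u-s}\quad(t\ge 0),\qquad Z^s_t=Y^s_{t+s}-Y^s_s\quad(t\ge -s),$$ and put $$X_t=\int_{\mathbb R} f_H(t,u)\,dL_u,\qquad Z^\infty_t=\frac{c_H}{C_H}X_t\quad(t\in\mathbb R).$$ Then all these stochastic integrals exist, and for every $t\in\mathbb R$ there are constants $S,C>0$ such that for all $s>S$ the random variable $Z^s_t-Z^\infty_t$ is square integrable and $$\mathbb E\left(Z^s_t-Z^\infty_t\right)^2\le C\,s^{2H-2}.$$ -/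

import Mathlib

open scoped Topology NNReal ENNReal

namespace FracLevy

section Hypergeometric

theorem poch_add (a : ℝ) (k m : ℕ) :
    (ascPochhammer ℝ (k + m)).eval a
      = (ascPochhammer ℝ k).eval a * (ascPochhammer ℝ m).eval (a + k) := by
  rw [← ascPochhammer_mul]; simp

theorem poch_succ' (a : ℝ) (m : ℕ) :
    (ascPochhammer ℝ (m + 1)).eval a = a * (ascPochhammer ℝ m).eval (a + 1) := by
  have := poch_add a 1 m
  rw [add_comm 1 m] at this
  simpa using this

theorem poch_pos {c : ℝ} (hc : 0 < c) (n : ℕ) : 0 < (ascPochhammer ℝ n).eval c :=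
  ascPochhammer_pos n c hc

theorem abs_poch_le (a : ℝ) (k m : ℕ) :
    |(ascPochhammer ℝ m).eval (a + k)| ≤ (ascPochhammer ℝ m).eval (|a| + k) := by
  induction m with
  | zero => simp
  | succ m ih =>
    rw [ascPochhammer_succ_eval, ascPochhammer_succ_eval, abs_mul]
    have h1 : |a + k + m| ≤ |a| + k + m := by
      rw [abs_le]; constructor <;>
      linarith [le_abs_self a, neg_abs_le a, (Nat.cast_nonneg k : (0:ℝ) ≤ k),
        (Nat.cast_nonneg m : (0:ℝ) ≤ m)]
    exact mul_le_mul ih h1 (abs_nonneg _) ((abs_nonneg _).trans ih)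

theorem vandermonde (n : ℕ) : ∀ c d : ℝ, 0 < c →
    ∑ k ∈ Finset.range (n + 1), (-1) ^ k * (n.choose k : ℝ)
        * ((ascPochhammer ℝ k).eval d / (ascPochhammer ℝ k).eval c)
      = (ascPochhammer ℝ n).eval (c - d) / (ascPochhammer ℝ n).eval c := by
  induction n with
  | zero => intro c d _; simp
  | succ n ih =>
    intro c d hc
    have h1 := ih c d hc
    have h2 := ih (c + 1) (d + 1) (by linarith)
    rw [show c + 1 - (d + 1) = c - d by ring] at h2
    have key : ∑ k ∈ Finset.range (n + 2), (-1) ^ k * ((n + 1).choose k : ℝ)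
        * ((ascPochhammer ℝ k).eval d / (ascPochhammer ℝ k).eval c)
        = (∑ k ∈ Finset.range (n + 1), (-1) ^ k * (n.choose k : ℝ)
            * ((ascPochhammer ℝ k).eval d / (ascPochhammer ℝ k).eval c))
        - d / c * ∑ k ∈ Finset.range (n + 1), (-1) ^ k * (n.choose k : ℝ)
            * ((ascPochhammer ℝ k).eval (d + 1) / (ascPochhammer ℝ k).eval (c + 1)) := by
      have e1 : ∑ k ∈ Finset.range (n + 1), (-1) ^ k * (n.choose k : ℝ)
            * ((ascPochhammer ℝ k).eval d / (ascPochhammer ℝ k).eval c)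
          = ∑ k ∈ Finset.range (n + 2), (-1) ^ k * (n.choose k : ℝ)
            * ((ascPochhammer ℝ k).eval d / (ascPochhammer ℝ k).eval c) := by
        rw [Finset.sum_range_succ _ (n + 1)]; simp
      rw [e1, Finset.sum_range_succ' _ (n + 1), Finset.sum_range_succ' _ (n + 1), Finset.mul_sum]
      have : ∀ k ∈ Finset.range (n + 1), (-1 : ℝ) ^ (k + 1) * ((n + 1).choose (k + 1) : ℝ)
          * ((ascPochhammer ℝ (k + 1)).eval d / (ascPochhammer ℝ (k + 1)).eval c)
          = (-1 : ℝ) ^ (k + 1) * (n.choose (k + 1) : ℝ)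
          * ((ascPochhammer ℝ (k + 1)).eval d / (ascPochhammer ℝ (k + 1)).eval c)
          - d / c * ((-1) ^ k * (n.choose k : ℝ)
            * ((ascPochhammer ℝ k).eval (d + 1) / (ascPochhammer ℝ k).eval (c + 1))) := by
        intro k _
        rw [Nat.choose_succ_succ, poch_succ', poch_succ']
        have := poch_pos (by linarith : 0 < c + 1) k
        push_cast
        field_simp
        ring
      rw [Finset.sum_congr rfl this, Finset.sum_sub_distrib]
      simp
      ring
    rw [key, h1, h2]
    have e2 : (ascPochhammer ℝ n).eval (c + 1) * c = (ascPochhammer ℝ n).eval c * (c + n) := by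
      rw [← ascPochhammer_succ_eval, poch_succ']; ring
    rw [ascPochhammer_succ_eval, ascPochhammer_succ_eval]
    have p1 := poch_pos hc n
    have p2 := poch_pos (by linarith : 0 < c + 1) n
    have p3 : 0 < c + n := by positivity
    have e3 : d / c * ((ascPochhammer ℝ n).eval (c - d) / (ascPochhammer ℝ n).eval (c + 1))
        = d * (ascPochhammer ℝ n).eval (c - d) / ((ascPochhammer ℝ n).eval c * (c + n)) := by
      rw [← e2]; field_simp
    rw [e3]
    field_simp
    ring

theorem hasSum_binom (α : ℝ) {x : ℝ} (hx : |x| < 1) :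
    HasSum (fun m : ℕ => (ascPochhammer ℝ m).eval α / (m.factorial : ℝ) * x ^ m)
      ((1 - x) ^ (-α)) := by
  have h := (Real.one_div_one_sub_rpow_hasFPowerSeriesOnBall_zero α).hasSum (y := x)
    (by simpa [Metric.mem_eball, edist_dist, enorm_eq_nnnorm, ← ENNReal.coe_one, ← NNReal.coe_lt_coe] using hx)
  have hpos : 0 < 1 - x := by linarith [(abs_lt.1 hx).2]
  rw [zero_add, one_div, ← Real.rpow_neg hpos.le] at h
  refine h.congr_fun fun m => ?_
  have hm : (m.factorial : ℝ) ≠ 0 := by exact_mod_cast m.factorial_ne_zero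
  have hc : Ring.choose (α + m - 1) m
      = (ascPochhammer ℝ m).eval α / (m.factorial : ℝ) := by
    rw [Ring.choose_eq_smul, Polynomial.descPochhammer_smeval_eq_ascPochhammer,
      show α + (m : ℝ) - 1 - m + 1 = α by ring, Polynomial.ascPochhammer_smeval_eq_eval,
      smul_eq_mul]
    field_simp
  simp [hc, mul_comm]

theorem one_le_radius (a b : ℝ) {c : ℝ} (hc : 0 < c) :
    1 ≤ (ordinaryHypergeometricSeries ℝ a b c).radius := by
  by_cases ha : ∃ k : ℕ, (k : ℝ) = -a
  · obtain ⟨k, hk⟩ := ha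
    obtain rfl : a = -(k : ℝ) := by linarith
    rw [ordinaryHypergeometric_radius_top_of_neg_nat₁]; exact le_top
  by_cases hb : ∃ k : ℕ, (k : ℝ) = -b
  · obtain ⟨k, hk⟩ := hb
    obtain rfl : b = -(k : ℝ) := by linarith
    rw [ordinaryHypergeometric_radius_top_of_neg_nat₂]; exact le_top
  push Not at ha hb
  rw [ordinaryHypergeometricSeries_radius_eq_one]
  refine fun k => ⟨ha k, hb k, fun h => ?_⟩
  have : (0:ℝ) ≤ k := Nat.cast_nonneg k
  linarith


theorem summable_coeff (a b : ℝ) {c x : ℝ} (hc : 0 < c) (hx : |x| < 1) :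
    Summable fun k : ℕ => |ordinaryHypergeometricCoefficient a b c k * x ^ k| := by
  have h := (ordinaryHypergeometricSeries ℝ a b c).summable_norm_apply (x := x)
    (Metric.eball_subset_eball (one_le_radius a b hc) (by
      simpa [Metric.mem_eball, edist_dist, enorm_eq_nnnorm, ← ENNReal.coe_one,
        ← NNReal.coe_lt_coe] using hx))
  simpa only [ordinaryHypergeometricSeries_apply_eq, smul_eq_mul, Real.norm_eq_abs] using h

theorem hasSum_2F1 (a b : ℝ) {c x : ℝ} (hc : 0 < c) (hx : |x| < 1) :
    HasSum (fun k : ℕ => ordinaryHypergeometricCoefficient a b c k * x ^ k) (₂F₁ a b c x) := by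
  have := (summable_coeff a b hc hx).of_abs.hasSum
  simpa only [ordinaryHypergeometric_eq_tsum, smul_eq_mul] using this

theorem pfaff_small (a b : ℝ) {c x : ℝ} (hc : 0 < c) (hx : |x| < 1 / 2) :
    (1 - x) ^ (-a) * ₂F₁ a (c - b) c (x / (x - 1)) = ₂F₁ a b c x := by
  have hx1 : |x| < 1 := by linarith
  have hpos : 0 < 1 - x := by linarith [(abs_lt.1 hx1).2]
  have hpos' : 0 < 1 - |x| := by linarith
  set A := ordinaryHypergeometricCoefficient a (c - b) c with hA
  set f : ℕ × ℕ → ℝ := fun p => A p.1 * (-x) ^ p.1 *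
    ((ascPochhammer ℝ p.2).eval (a + p.1) / (p.2.factorial : ℝ) * x ^ p.2) with hf
  have hy : |x / (x - 1)| < 1 := by
    rw [abs_div, abs_sub_comm x 1, abs_of_pos hpos, div_lt_one hpos]
    linarith [(abs_lt.1 hx).2]
  have hz : |(|x| / (1 - |x|))| < 1 := by
    rw [abs_div, abs_abs, abs_of_pos hpos', div_lt_one hpos']
    linarith
  -- rows
  have hrow : ∀ k : ℕ, HasSum (fun m => f (k, m))
      ((1 - x) ^ (-a) * (A k * (x / (x - 1)) ^ k)) := by
    intro k
    have h := (hasSum_binom (a + k) hx1).mul_left (A k * (-x) ^ k)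
    have e : (1 - x) ^ (-a) * (A k * (x / (x - 1)) ^ k)
        = A k * (-x) ^ k * (1 - x) ^ (-(a + k)) := by
      rw [neg_add, Real.rpow_add hpos, Real.rpow_neg hpos.le (k : ℝ), Real.rpow_natCast,
        show x / (x - 1) = (-x) / (1 - x) by rw [← neg_sub 1 x, div_neg, neg_div], div_pow]
      field_simp
    rw [e]
    exact h
  have hsum : Summable f := by
    set g : ℕ × ℕ → ℝ := fun p => |A p.1| * |x| ^ p.1 *
      ((ascPochhammer ℝ p.2).eval (|a| + p.1) / (p.2.factorial : ℝ) * |x| ^ p.2) with hg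
    have hP : ∀ k m : ℕ, 0 ≤ (ascPochhammer ℝ m).eval (|a| + k) :=
      fun k m => (abs_nonneg _).trans (abs_poch_le a k m)
    have hgs : Summable g := by
      have hg0 : 0 ≤ g := by
        intro p
        have := hP p.1 p.2
        simp only [hg, Pi.zero_apply]
        positivity
      have hgrow : ∀ k : ℕ, HasSum (fun m => g (k, m))
          ((1 - |x|) ^ (-|a|) * |A k * (|x| / (1 - |x|)) ^ k|) := by
        intro k
        have h := (hasSum_binom (|a| + k) (x := |x|) (by rwa [abs_abs])).mul_left
          (|A k| * |x| ^ k)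
        have e : (1 - |x|) ^ (-|a|) * |A k * (|x| / (1 - |x|)) ^ k|
            = |A k| * |x| ^ k * (1 - |x|) ^ (-(|a| + k)) := by
          rw [neg_add, Real.rpow_add hpos', Real.rpow_neg hpos'.le (k : ℝ), Real.rpow_natCast,
            abs_mul, abs_of_nonneg (by positivity : 0 ≤ (|x| / (1 - |x|)) ^ k), div_pow]
          field_simp
        rw [e]
        exact h
      refine (summable_prod_of_nonneg hg0).2 ⟨fun k => (hgrow k).summable, ?_⟩
      simp_rw [fun k => (hgrow k).tsum_eq]
      exact (summable_coeff a (c - b) hc hz).mul_left _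
    refine Summable.of_norm_bounded hgs fun p => ?_
    simp only [hf, hg, Real.norm_eq_abs, abs_mul, abs_pow, abs_neg, abs_div, Nat.abs_cast]
    gcongr
    exact abs_poch_le a p.1 p.2
  have h1 : HasSum f ((1 - x) ^ (-a) * ₂F₁ a (c - b) c (x / (x - 1))) := by
    have h := hsum.hasSum.prod_fiberwise hrow
    have h' := (hasSum_2F1 a (c - b) hc hy).mul_left ((1 - x) ^ (-a))
    rw [← h.unique h']
    exact hsum.hasSum
  have h2 : HasSum (fun n => ordinaryHypergeometricCoefficient a b c n * x ^ n)
      ((1 - x) ^ (-a) * ₂F₁ a (c - b) c (x / (x - 1))) := by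
    have h := (Finset.HasAntidiagonal.sigmaAntidiagonalEquivProd (A := ℕ)).hasSum_iff.2 h1
    refine h.sigma fun n => ?_
    have hd : ∑ p ∈ Finset.HasAntidiagonal.antidiagonal n, f p
        = ordinaryHypergeometricCoefficient a b c n * x ^ n := by
      rw [Finset.Nat.sum_antidiagonal_eq_sum_range_succ_mk]
      have hv := vandermonde n c (c - b) hc
      rw [sub_sub_cancel] at hv
      have hn : (n.factorial : ℝ) ≠ 0 := by exact_mod_cast n.factorial_ne_zero
      have : ordinaryHypergeometricCoefficient a b c n * x ^ n
          = (ascPochhammer ℝ n).eval a * x ^ n / (n.factorial : ℝ)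
            * ((ascPochhammer ℝ n).eval b / (ascPochhammer ℝ n).eval c) := by
        simp only [ordinaryHypergeometricCoefficient]
        field_simp
      rw [this, ← hv, Finset.mul_sum]
      refine Finset.sum_congr rfl fun k hk => ?_
      have hkn : k ≤ n := Nat.lt_succ_iff.1 (Finset.mem_range.1 hk)
      have e1 := poch_add a k (n - k)
      rw [Nat.add_sub_cancel' hkn] at e1
      have e2 : x ^ n = x ^ k * x ^ (n - k) := by rw [← pow_add, Nat.add_sub_cancel' hkn]
      have hk0 : (k.factorial : ℝ) ≠ 0 := by exact_mod_cast k.factorial_ne_zero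
      have hnk0 : ((n - k).factorial : ℝ) ≠ 0 := by exact_mod_cast (n - k).factorial_ne_zero
      have hc0 := (poch_pos hc k).ne'
      simp only [hf, hA, ordinaryHypergeometricCoefficient]
      rw [e1, e2, Nat.cast_choose ℝ hkn, neg_pow]
      field_simp
    rw [← hd]
    have := hasSum_fintype (fun q : Finset.HasAntidiagonal.antidiagonal n => f q)
    rw [Finset.sum_coe_sort (Finset.HasAntidiagonal.antidiagonal n) f] at this
    exact this
  exact h2.unique (hasSum_2F1 a b hc hx1)

theorem analyticAt_2F1 (a b : ℝ) {c x : ℝ} (hc : 0 < c) (hx : |x| < 1) :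
    AnalyticAt ℝ (₂F₁ a b c : ℝ → ℝ) x := by
  have h1 := one_le_radius a b hc
  have h := (ordinaryHypergeometricSeries ℝ a b c).hasFPowerSeriesOnBall
    (lt_of_lt_of_le one_pos h1)
  exact h.analyticAt_of_mem (Metric.eball_subset_eball h1 (by
      simpa [Metric.mem_eball, edist_dist, enorm_eq_nnnorm, ← ENNReal.coe_one,
        ← NNReal.coe_lt_coe] using hx))

theorem analyticAt_pfaff (a b : ℝ) {c x : ℝ} (hc : 0 < c) (hx : x < 1 / 2) :
    AnalyticAt ℝ (fun x : ℝ => (1 - x) ^ (-a) * ₂F₁ a (c - b) c (x / (x - 1))) x := by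
  have hy : |x / (x - 1)| < 1 := by
    rw [abs_div, abs_sub_comm x 1, abs_of_pos (by linarith : 0 < 1 - x),
      div_lt_one (by linarith), abs_lt]
    constructor <;> linarith
  have h0 : AnalyticAt ℝ (fun x : ℝ => x / (x - 1)) x :=
    analyticAt_id.div (analyticAt_id.sub analyticAt_const) (by simp; linarith)
  have h1 : AnalyticAt ℝ (fun x : ℝ => (1 - x) ^ (-a)) x := by
    have hl : AnalyticAt ℝ (fun x : ℝ => Real.exp (Real.log (1 - x) * (-a))) x :=
      (((analyticAt_const.sub analyticAt_id).log (by simp; linarith)).mul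
        analyticAt_const).rexp'
    refine hl.congr ?_
    filter_upwards [Iio_mem_nhds (by linarith : x < 1)] with y hy
    rw [Real.rpow_def_of_pos (by linarith [Set.mem_Iio.1 hy])]
  exact h1.mul ((analyticAt_2F1 a (c - b) hc hy).comp_of_eq h0 rfl)

theorem pfaff (a b : ℝ) {c x : ℝ} (hc : 0 < c) (hx : -1 < x) (hx' : x < 1 / 2) :
    ₂F₁ a b c x = (1 - x) ^ (-a) * ₂F₁ a (c - b) c (x / (x - 1)) := by
  have hA : AnalyticOnNhd ℝ (₂F₁ a b c : ℝ → ℝ) (Set.Ioo (-1) (1 / 2)) := fun y hy =>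
    analyticAt_2F1 a b hc (abs_lt.2 ⟨hy.1, by linarith [hy.2]⟩)
  have hB : AnalyticOnNhd ℝ (fun x : ℝ => (1 - x) ^ (-a) * ₂F₁ a (c - b) c (x / (x - 1)))
      (Set.Ioo (-1) (1 / 2)) := fun y hy => analyticAt_pfaff a b hc hy.2
  refine hA.eqOn_of_preconnected_of_eventuallyEq hB isPreconnected_Ioo (z₀ := 0)
    (by norm_num) ?_ ⟨hx, hx'⟩
  filter_upwards [Metric.ball_mem_nhds (0 : ℝ) (by norm_num : (0 : ℝ) < 1 / 2)] with y hy
  exact (pfaff_small a b hc (by simpa using hy)).symm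

/-- Gauss' hypergeometric function `F(a, b, c, x)` for real `x < 1` (and `c > 0`): the power series
on `(-1, 1)` and its real-analytic continuation to `(-∞, -1]`, which is given by the Pfaff
transformation. That this is indeed the analytic continuation is proved below in
`gaussF_analyticOnNhd`. (Only arguments `x < 0` are used by the kernel.) -/
noncomputable def gaussF (a b c x : ℝ) : ℝ :=
  if |x| < 1 then ₂F₁ a b c x else (1 - x) ^ (-a) * ₂F₁ a (c - b) c (x / (x - 1))

/-- For `x < 1/2`, in particular for all `x ≤ 0`, the function is given by a single formula. -/
theorem gaussF_eq_pfaff (a b : ℝ) {c x : ℝ} (hc : 0 < c) (hx : x < 1 / 2) :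
    gaussF a b c x = (1 - x) ^ (-a) * ₂F₁ a (c - b) c (x / (x - 1)) := by
  unfold gaussF
  split_ifs with h
  · exact pfaff a b hc (abs_lt.1 h).1 hx
  · rfl

/-- `gaussF a b c` is real-analytic on the whole of `(-∞, 1)`. -/
theorem gaussF_analyticOnNhd (a b : ℝ) {c : ℝ} (hc : 0 < c) :
    AnalyticOnNhd ℝ (gaussF a b c) (Set.Iio 1) := by
  intro x hx
  by_cases h : x < 1 / 2
  · refine (analyticAt_pfaff a b hc h).congr ?_
    filter_upwards [Iio_mem_nhds h] with y hy
    exact (gaussF_eq_pfaff a b hc hy).symm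
  · have hx1 : x ∈ Set.Ioo (-1 : ℝ) 1 := ⟨by linarith, hx⟩
    refine (analyticAt_2F1 a b hc (abs_lt.2 hx1)).congr ?_
    filter_upwards [isOpen_Ioo.mem_nhds hx1] with y hy
    rw [gaussF, if_pos (abs_lt.2 hy)]

end Hypergeometric

section Kernels

/-- The power `x_+ ^ p`, equal to `x ^ p` for `x > 0` and to `0` for `x ≤ 0`. -/
noncomputable def posPow (x p : ℝ) : ℝ := if 0 < x then x ^ p else 0

/-- The normalising constant `C_H` of the Mandelbrot-Van Ness kernel. -/
noncomputable def CMvN (H : ℝ) : ℝ :=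
  ((∫ s in Set.Ioi (0 : ℝ), ((1 + s) ^ (H - 1 / 2) - s ^ (H - 1 / 2)) ^ 2) + 1 / (2 * H))
    ^ (-(1 / 2) : ℝ)

/-- The Mandelbrot-Van Ness kernel `f_H(t, s)`. -/
noncomputable def fKernel (H t s : ℝ) : ℝ :=
  CMvN H * (posPow (t - s) (H - 1 / 2) - posPow (-s) (H - 1 / 2))

/-- The normalising constant `c_H` of the Molchan-Golosov kernel. -/
noncomputable def cMG (H : ℝ) : ℝ :=
  1 / Real.Gamma (H + 1 / 2) *
    (2 * H * Real.Gamma (H + 1 / 2) * Real.Gamma (3 / 2 - H) / Real.Gamma (2 - 2 * H))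
      ^ (1 / 2 : ℝ)

/-- The Molchan-Golosov kernel `z_H(t, s)`, zero unless `0 < s < t`. -/
noncomputable def zKernel (H t s : ℝ) : ℝ :=
  if 0 < s ∧ s < t then
    cMG H * (t - s) ^ (H - 1 / 2) * gaussF (1 / 2 - H) (H - 1 / 2) (H + 1 / 2) ((s - t) / s)
  else 0

end Kernels

section Levy

open MeasureTheory ProbabilityTheory Filter

variable {Ω : Type*} [MeasurableSpace Ω]

/-- Real-valued Levy processes on `[0, ∞)`. -/
structure IsLevy (X : ℝ≥0 → Ω → ℝ) (P : Measure Ω) : Prop where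
  measurable : ∀ t, Measurable (X t)
  zero : ∀ᵐ ω ∂P, X 0 ω = 0
  indep : HasIndepIncrements X P
  stationary : ∀ s t, IdentDistrib (fun ω => X (s + t) ω - X s ω) (X t) P P
  cadlag : ∀ᵐ ω ∂P, ∀ t, ContinuousWithinAt (fun u => X u ω) (Set.Ici t) t ∧
    ∃ l, Tendsto (fun u => X u ω) (𝓝[<] t) (𝓝 l)

/-- Two-sided Levy processes: `L_t = L₁_t` for `t ≥ 0` and `L_t = -L₂_{(-t)-}` for `t < 0`, with
`L₁`, `L₂` independent and identically distributed Levy processes. -/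
def IsTwoSidedLevy (L : ℝ → Ω → ℝ) (P : Measure Ω) : Prop :=
  ∃ L₁ L₂ : ℝ≥0 → Ω → ℝ, IsLevy L₁ P ∧ IsLevy L₂ P ∧
    IdentDistrib (fun ω t => L₁ t ω) (fun ω t => L₂ t ω) P P ∧
    IndepFun (fun ω t => L₁ t ω) (fun ω t => L₂ t ω) P ∧
    ∀ t ω, L t ω = if 0 ≤ t then L₁ t.toNNReal ω
      else -Function.leftLim (fun u => L₂ u ω) (-t).toNNReal

/-- Step functions `∑ i, coef i * 1_{(left i, right i]}` on the real line. -/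
structure StepFun where
  n : ℕ
  coef : Fin n → ℝ
  left : Fin n → ℝ
  right : Fin n → ℝ
  left_le_right : ∀ i, left i ≤ right i

/-- The function on `ℝ` given by a step function. -/
noncomputable def StepFun.eval (φ : StepFun) (x : ℝ) : ℝ :=
  ∑ i, φ.coef i * (Set.Ioc (φ.left i) (φ.right i)).indicator 1 x

/-- The elementary integral `∑ i, coef i * (L_{right i} - L_{left i})` of a step function. -/
def StepFun.integral (φ : StepFun) (L : ℝ → Ω → ℝ) (ω : Ω) : ℝ :=
  ∑ i, φ.coef i * (L (φ.right i) ω - L (φ.left i) ω)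

/-- `I` is (a version of) the stochastic integral `∫ g dL` over the real line of the deterministic
function `g`: the `L²(P)`-limit of elementary integrals of step functions converging to `g` in
`L²(ℝ)`. -/
def IsLevyIntegral (P : Measure Ω) (g : ℝ → ℝ) (L : ℝ → Ω → ℝ) (I : Ω → ℝ) : Prop :=
  MemLp g 2 volume ∧ MemLp I 2 P ∧ ∃ φ : ℕ → StepFun,
    Tendsto (fun n => eLpNorm (fun x => (φ n).eval x - g x) 2 volume) atTop (𝓝 0) ∧
    Tendsto (fun n => eLpNorm (fun ω => (φ n).integral L ω - I ω) 2 P) atTop (𝓝 0)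

/-- The stochastic integral `∫ g dL` exists. -/
def LevyIntegrable (P : Measure Ω) (g : ℝ → ℝ) (L : ℝ → Ω → ℝ) : Prop :=
  ∃ I, IsLevyIntegral P g L I

open Classical in
/-- The stochastic integral `∫ g dL` (a version of it; `0` if it does not exist). -/
noncomputable def levyIntegral (P : Measure Ω) (g : ℝ → ℝ) (L : ℝ → Ω → ℝ) : Ω → ℝ :=
  if h : LevyIntegrable P g L then h.choose else 0

/-- The fractional Levy process `X_t = ∫ f_H(t, u) dL_u` by Mandelbrot-Van Ness transformation. -/
noncomputable def flpMvN (P : Measure Ω) (H : ℝ) (L : ℝ → Ω → ℝ) (t : ℝ) : Ω → ℝ :=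
  levyIntegral P (fKernel H t) L

/-- The fractional Levy process `Y_t = ∫_0^t z_H(t, u) dL_u` by Molchan-Golosov transformation. -/
noncomputable def flpMG (P : Measure Ω) (H : ℝ) (L : ℝ → Ω → ℝ) (t : ℝ) : Ω → ℝ :=
  levyIntegral P (zKernel H t) L

/-- The shifted driving process `u ↦ L_{u - s}`. -/
def shift (s : ℝ) (L : ℝ → Ω → ℝ) (u : ℝ) : Ω → ℝ := L (u - s)

/-- The process `Z^s_t = Y^s_{t + s} - Y^s_s`, where `Y^s_t = ∫_0^t z_H(t, u) dL_{u - s}`. -/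
noncomputable def shiftedMG (P : Measure Ω) (H : ℝ) (L : ℝ → Ω → ℝ) (s t : ℝ) (ω : Ω) : ℝ :=
  flpMG P H (shift s L) (t + s) ω - flpMG P H (shift s L) s ω

/-- The process `Z^∞_t = (c_H / C_H) X_t`. -/
noncomputable def limitMvN (P : Measure Ω) (H : ℝ) (L : ℝ → Ω → ℝ) (t : ℝ) (ω : Ω) : ℝ :=
  cMG H / CMvN H * flpMvN P H L t ω

end Levy

end FracLevy

namespace FracLevy

/-! ### The first-order equation for the hypergeometric factor of the Molchan–Golosov kernel, and
its bounds. -/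

section HypergeometricODE

/-! Put `a = H - 1/2` and `G w = F(-a, a, a+1, -w)`. By linearity and the isometry `E(∫ g dL)² = v
‖g‖²`, the error equals `v` times the squared `L²(ℝ)` norm of one deterministic kernel,
`kernelDiff`, so the rate is a statement about kernels.

Since the third parameter exceeds the second by one, `G` satisfies a first-order equation,
equivalently `(w^a G(w))' = a w^(a-1) (1+w)^a`. For `-s < u < 0` the kernel difference is therefore
`c_H` times the integral over `r ∈ [0, t]` of `a (r-u)^(a-1) ((1 + (r-u)/(u+s))^a - 1)`; the
Mandelbrot–Van Ness kernel is the part that supplies the `-1`. The mean value inequality turns this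
into a pointwise bound (`abs_mgDiff_le`).

Four ranges of `u` then each contribute at most order `s^(2H-2)` to the squared norm. For `u ≤ -s`
only the Mandelbrot–Van Ness tail of order `(-u)^(a-1)` remains. For `-s < u < -s/2` the bound is
`s^(a-1)` times a factor with singularity `(u+s)^(-|a|)`, square integrable because `2|a| < 1`. For
`-s/2 ≤ u < 0` the bound is `s⁻¹` times powers with exponent `a`. For `0 ≤ u < t` it is of order
`s⁻¹`. Negative times reduce to positive ones by translation (`kernelDiff_neg_time`).

The isometry needs only `E(L_t - L_s)² = v |t - s|`. Polarization makes the Gram matrix of the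
increments `v` times that of the interval indicators, and step functions are dense in `L²(ℝ)`. -/

theorem hasSum_mul_deriv_2F1 (a b : ℝ) {c x : ℝ} (hc : 0 < c) (hx : |x| < 1) :
    HasSum (fun n : ℕ => n * (ordinaryHypergeometricCoefficient a b c n * x ^ n))
      (x * deriv (₂F₁ a b c) x) := by
  have h1 := one_le_radius a b hc
  have h := ((ordinaryHypergeometricSeries ℝ a b c).hasFPowerSeriesOnBall
    (lt_of_lt_of_le one_pos h1)).fderiv.hasSum (y := x)
    (Metric.eball_subset_eball h1 (by
      simpa [Metric.mem_eball, edist_dist, enorm_eq_nnnorm, ← ENNReal.coe_one,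
        ← NNReal.coe_lt_coe] using hx))
  have h2 := h.mapL (ContinuousLinearMap.apply ℝ ℝ x)
  simp only [ContinuousLinearMap.apply_apply,
    FormalMultilinearSeries.derivSeries_apply_diag, zero_add] at h2
  rw [← hasSum_nat_add_iff' 1]
  have e : fderiv ℝ (ordinaryHypergeometricSeries ℝ a b c).sum x x
      = x * deriv (₂F₁ a b c) x := by
    rw [fderiv_eq_smul_deriv]; rfl
  rw [e] at h2
  convert h2 using 1
  · ext n
    rw [ordinaryHypergeometricSeries_apply_eq, nsmul_eq_mul, smul_eq_mul]
  · simp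

theorem poch_shift (a : ℝ) (n : ℕ) :
    (ascPochhammer ℝ n).eval a * (a + n) = a * (ascPochhammer ℝ n).eval (a + 1) := by
  rw [← ascPochhammer_succ_eval, poch_succ']

/-- Comparing coefficients, the identity is `(a)_n (a + n) = a (a + 1)_n`: the choice `c = b + 1`
collapses the series on the left to a binomial one. -/
theorem ode_2F1 {a x : ℝ} (ha : -1 < a) (hx : |x| < 1) :
    x * deriv (₂F₁ (-a) a (a + 1)) x + a * ₂F₁ (-a) a (a + 1) x = a * (1 - x) ^ a := by
  have hc : 0 < a + 1 := by linarith
  have h1 := (hasSum_mul_deriv_2F1 (-a) a hc hx).add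
    ((hasSum_2F1 (-a) a hc hx).mul_left a)
  have h2 := (hasSum_binom (-a) hx).mul_left a
  rw [neg_neg] at h2
  refine h1.unique (h2.congr_fun fun n => ?_)
  have hp := (poch_pos hc n).ne'
  have hn : (n.factorial : ℝ) ≠ 0 := by exact_mod_cast n.factorial_ne_zero
  have hs := poch_shift a n
  simp only [ordinaryHypergeometricCoefficient]
  field_simp
  linear_combination (ascPochhammer ℝ n).eval (-a) * x ^ n * hs

theorem gaussF_zero (a b c : ℝ) : gaussF a b c 0 = 1 := by
  simp [gaussF]

/-- Both sides are analytic on `(-∞, 1)` and agree on the unit disc, so the identity theorem carries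
the equation over to the continuation. -/
theorem ode_gaussF {a x : ℝ} (ha : -1 < a) (hx : x < 1) :
    x * deriv (gaussF (-a) a (a + 1)) x + a * gaussF (-a) a (a + 1) x = a * (1 - x) ^ a := by
  have hc : 0 < a + 1 := by linarith
  have hF := gaussF_analyticOnNhd (-a) a hc
  have hA : AnalyticOnNhd ℝ (fun x => x * deriv (gaussF (-a) a (a + 1)) x
      + a * gaussF (-a) a (a + 1) x) (Set.Iio 1) := fun y hy =>
    (analyticAt_id.mul (hF.deriv y hy)).add (analyticAt_const.mul (hF y hy))
  have hB : AnalyticOnNhd ℝ (fun x : ℝ => a * (1 - x) ^ a) (Set.Iio 1) := by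
    intro y hy
    have hy' : y < 1 := hy
    have hl : AnalyticAt ℝ (fun x : ℝ => Real.exp (Real.log (1 - x) * a)) y :=
      (((analyticAt_const.sub analyticAt_id).log (by simp; linarith)).mul
        analyticAt_const).rexp'
    refine analyticAt_const.mul (hl.congr ?_)
    filter_upwards [Iio_mem_nhds hy'] with z hz
    rw [Real.rpow_def_of_pos (by linarith [Set.mem_Iio.1 hz])]
  refine hA.eqOn_of_preconnected_of_eventuallyEq hB isPreconnected_Iio (z₀ := 0)
    (by simp) ?_ hx
  have hball : Metric.ball (0 : ℝ) 1 ∈ 𝓝 (0 : ℝ) := Metric.ball_mem_nhds _ one_pos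
  filter_upwards [hball] with y hy
  have hy1 : |y| < 1 := by simpa using hy
  have hev : gaussF (-a) a (a + 1) =ᶠ[𝓝 y] ₂F₁ (-a) a (a + 1) := by
    filter_upwards [Metric.isOpen_ball.mem_nhds hy] with z hz
    have : |z| < 1 := by simpa using hz
    simp [gaussF, this]
  rw [hev.deriv_eq, hev.eq_of_nhds]
  exact ode_2F1 ha hy1

/-- The function `w ↦ F(-a, a, a + 1, -w)` on `(-1, ∞)`. -/
noncomputable def mgFun (a w : ℝ) : ℝ := gaussF (-a) a (a + 1) (-w)

theorem mgFun_zero (a : ℝ) : mgFun a 0 = 1 := by simp [mgFun, gaussF_zero]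

theorem mgFun_analyticAt {a w : ℝ} (ha : -1 < a) (hw : -1 < w) : AnalyticAt ℝ (mgFun a) w :=
  (gaussF_analyticOnNhd (-a) a (by linarith : 0 < a + 1) (-w)
    (by simp; linarith)).comp_of_eq analyticAt_id.neg rfl

theorem ode_mgFun {a w : ℝ} (ha : -1 < a) (hw : -1 < w) :
    w * deriv (mgFun a) w + a * mgFun a w = a * (1 + w) ^ a := by
  have h := ode_gaussF ha (x := -w) (by linarith)
  have hd : deriv (mgFun a) w = - deriv (gaussF (-a) a (a + 1)) (-w) :=
    deriv_comp_neg (gaussF (-a) a (a + 1)) w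
  rw [hd, mgFun]
  rw [sub_neg_eq_add] at h
  linarith

/-- The factor `w ^ a` is the integrating factor of `ode_mgFun`; no hypergeometric function is left
in the derivative. -/
theorem hasDerivAt_rpow_mul_mgFun {a w : ℝ} (ha : -1 < a) (hw : 0 < w) :
    HasDerivAt (fun w => w ^ a * mgFun a w) (a * w ^ (a - 1) * (1 + w) ^ a) w := by
  have h := (Real.hasDerivAt_rpow_const (p := a) (Or.inl hw.ne')).mul
    (mgFun_analyticAt ha (by linarith)).differentiableAt.hasDerivAt
  refine h.congr_deriv ?_
  have ho := ode_mgFun ha (by linarith : -1 < w)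
  have e : w ^ a = w ^ (a - 1) * w := by
    rw [← Real.rpow_add_one hw.ne']; ring_nf
  rw [e]
  linear_combination w ^ (a - 1) * ho

theorem hasDerivAt_rpow_mul_mgFun_sub_one {a w : ℝ} (ha : -1 < a) (hw : 0 < w) :
    HasDerivAt (fun w => w ^ a * (mgFun a w - 1)) (a * w ^ (a - 1) * ((1 + w) ^ a - 1)) w := by
  have h := (hasDerivAt_rpow_mul_mgFun ha hw).sub
    (Real.hasDerivAt_rpow_const (p := a) (Or.inl hw.ne'))
  exact (h.congr_deriv (by ring)).congr_of_eventuallyEq (Filter.Eventually.of_forall fun y => by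
    simp [mul_sub])

/-- Bernoulli's inequality for `a ≥ 0`. For `a ≤ 0` it is applied to `-a`, and the reciprocal is
bounded by `1 / (1 - a y) ≥ 1 + a y`. -/
theorem abs_rpow_one_add_sub_one_le {a y : ℝ} (ha : |a| ≤ 1) (hy : 0 ≤ y) :
    |(1 + y) ^ a - 1| ≤ |a| * y := by
  rcases le_total 0 a with h0 | h0
  · rw [abs_of_nonneg h0, abs_of_nonneg]
    · linarith [rpow_one_add_le_one_add_mul_self (by linarith : -1 ≤ y) h0
        ((le_abs_self a).trans ha)]
    · linarith [Real.one_le_rpow (by linarith : 1 ≤ 1 + y) h0]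
  · have h1 : 1 + a * y ≤ (1 + y) ^ a := by
      have hp := rpow_one_add_le_one_add_mul_self (by linarith : -1 ≤ y) (neg_nonneg.2 h0)
        ((neg_le_abs a).trans ha)
      have hpos : 0 < (1 + y) ^ a := by positivity
      have e : (1 + y) ^ (-a) * (1 + y) ^ a = 1 := by
        rw [← Real.rpow_add (by linarith)]; simp
      have hy' : 0 ≤ -a * y := by nlinarith
      nlinarith [mul_le_mul_of_nonneg_right hp hpos.le, mul_nonneg hy' hy']
    have h2 := Real.rpow_le_one_of_one_le_of_nonpos (by linarith : 1 ≤ 1 + y) h0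
    rw [abs_of_nonpos h0, abs_of_nonpos (by linarith)]
    linarith

theorem exists_abs_mgFun_sub_one_le {a : ℝ} (ha : -1 < a) :
    ∃ C, 0 < C ∧ ∀ w, 0 ≤ w → w ≤ 1 → |mgFun a w - 1| ≤ C * w := by
  have hc : ContinuousOn (deriv (mgFun a)) (Set.Icc 0 1) := fun w hw =>
    (mgFun_analyticAt ha (by linarith [hw.1])).deriv.continuousAt.continuousWithinAt
  obtain ⟨C, hC⟩ := isCompact_Icc.exists_bound_of_continuousOn hc
  refine ⟨max C 1, by positivity, fun w h0 h1 => ?_⟩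
  have := (convex_Icc (0 : ℝ) 1).norm_image_sub_le_of_norm_deriv_le
    (f := mgFun a) (C := max C 1)
    (fun y hy => (mgFun_analyticAt ha (by linarith [hy.1])).differentiableAt)
    (fun y hy => (hC y hy).trans (le_max_left _ _)) (x := 0) (y := w) (by simp) ⟨h0, h1⟩
  simpa [mgFun_zero, abs_of_nonneg h0] using this

/-- The derivative of `w ^ a * mgFun a w` is at most of order `w ^ (a + b - 1)`, and integrating
gives the growth. Strictness in `|a| < b` gives `a + b > 0`, so that one comparison function serves
both signs of `a`. -/
theorem exists_abs_mgFun_le {a b : ℝ} (ha : -1 < a) (ha1 : a ≤ 1) (hab : |a| < b) :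
    ∃ C, 0 < C ∧ ∀ w, 0 ≤ w → |mgFun a w| ≤ C * (1 + w) ^ b := by
  obtain ⟨C₀, hC₀, h₀⟩ := exists_abs_mgFun_sub_one_le ha
  have hb : 0 < b := (abs_nonneg a).trans_lt hab
  have hab' : 0 < a + b := by linarith [neg_abs_le a]
  have ha2 : |a| ≤ 1 := abs_le.2 ⟨ha.le, ha1⟩
  have hsmall : ∀ w, 0 ≤ w → w ≤ 1 → |mgFun a w| ≤ C₀ + 1 := fun w h0 h1 => by
    have h := h₀ w h0 h1
    have : |mgFun a w| ≤ |mgFun a w - 1| + 1 := by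
      simpa using abs_add_le (mgFun a w - 1) 1
    nlinarith
  -- `C₀ + 1` covers the value at `w = 1`; `2 / (a + b)` makes the derivative of `D * w ^ (a + b)`
  -- dominate.
  set D := C₀ + 1 + 2 / (a + b) with hD
  have hDpos : 0 < D := by positivity
  have hbig : ∀ w, 1 ≤ w → |w ^ a * mgFun a w| ≤ D * w ^ (a + b) := by
    intro w hw
    have hder : ∀ x ∈ Set.Icc 1 w, HasDerivAt (fun w => w ^ a * mgFun a w)
        (a * x ^ (a - 1) * (1 + x) ^ a) x := fun x hx =>
      hasDerivAt_rpow_mul_mgFun ha (by linarith [hx.1])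
    have hB : ∀ x ∈ Set.Icc 1 w, HasDerivAt (fun w : ℝ => D * w ^ (a + b))
        (D * ((a + b) * x ^ (a + b - 1))) x := fun x hx =>
      (Real.hasDerivAt_rpow_const (Or.inl (by linarith [hx.1]))).const_mul D
    refine image_norm_le_of_norm_deriv_right_le_deriv_boundary'
      (f' := fun x => a * x ^ (a - 1) * (1 + x) ^ a) (B' := fun x => D * ((a + b) * x ^ (a + b - 1)))
      (fun x hx => (hder x hx).continuousAt.continuousWithinAt)
      (fun x hx => (hder x ⟨hx.1, hx.2.le⟩).hasDerivWithinAt) ?_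
      (fun x hx => (hB x hx).continuousAt.continuousWithinAt)
      (fun x hx => (hB x ⟨hx.1, hx.2.le⟩).hasDerivWithinAt) ?_ ⟨hw, le_rfl⟩
    · simp only [Real.one_rpow, one_mul, mul_one, Real.norm_eq_abs]
      refine (hsmall 1 zero_le_one le_rfl).trans ?_
      rw [hD]; linarith [show 0 < 2 / (a + b) by positivity]
    · intro x hx
      have hx0 : 0 < x := by linarith [hx.1]
      have e1 : (1 + x) ^ a ≤ 2 * x ^ b := by
        calc (1 + x) ^ a ≤ (1 + x) ^ |a| :=
              Real.rpow_le_rpow_of_exponent_le (by linarith) (le_abs_self a)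
          _ ≤ (2 * x) ^ |a| := Real.rpow_le_rpow (by linarith) (by linarith [hx.1]) (abs_nonneg a)
          _ = 2 ^ |a| * x ^ |a| := Real.mul_rpow (by norm_num) hx0.le
          _ ≤ 2 * x ^ b := by
            refine mul_le_mul ?_ (Real.rpow_le_rpow_of_exponent_le hx.1 hab.le) (by positivity)
              (by norm_num)
            simpa using Real.rpow_le_rpow_of_exponent_le (by norm_num : (1 : ℝ) ≤ 2) ha2
      have e2 : x ^ (a + b - 1) = x ^ (a - 1) * x ^ b := by
        rw [← Real.rpow_add hx0]; ring_nf
      have e3 : 2 ≤ D * (a + b) := by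
        have : 2 / (a + b) * (a + b) = 2 := by field_simp
        rw [hD]; nlinarith
      rw [Real.norm_eq_abs, abs_mul, abs_mul, abs_of_pos (by positivity : 0 < x ^ (a - 1)),
        abs_of_pos (by positivity : 0 < (1 + x) ^ a), e2]
      have hp : 0 < x ^ (a - 1) * x ^ b := by positivity
      calc |a| * x ^ (a - 1) * (1 + x) ^ a ≤ 1 * x ^ (a - 1) * (2 * x ^ b) := by gcongr
        _ = 2 * (x ^ (a - 1) * x ^ b) := by ring
        _ ≤ D * (a + b) * (x ^ (a - 1) * x ^ b) := by gcongr
        _ = _ := by ring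
  refine ⟨D, hDpos, fun w hw => ?_⟩
  have hone : 1 ≤ (1 + w) ^ b := Real.one_le_rpow (by linarith) hb.le
  rcases le_total w 1 with h1 | h1
  · refine (hsmall w hw h1).trans ?_
    have : C₀ + 1 ≤ D := by rw [hD]; linarith [show 0 < 2 / (a + b) by positivity]
    nlinarith
  · have hw0 : 0 < w := by linarith
    have h := hbig w h1
    rw [abs_mul, abs_of_pos (by positivity : 0 < w ^ a), Real.rpow_add hw0] at h
    have h' : |mgFun a w| ≤ D * w ^ b := by
      have hp : 0 < w ^ a := by positivity
      refine le_of_mul_le_mul_left ?_ hp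
      linarith
    refine h'.trans ?_
    gcongr
    linarith

end HypergeometricODE

/-! ### Integrals of powers over half-lines and intervals. -/

section KernelBounds

open MeasureTheory Set

theorem posPow_of_pos {x : ℝ} (hx : 0 < x) (p : ℝ) : posPow x p = x ^ p := if_pos hx

theorem posPow_of_nonpos {x : ℝ} (hx : x ≤ 0) (p : ℝ) : posPow x p = 0 := if_neg hx.not_gt

theorem measurable_posPow (p : ℝ) : Measurable fun x => posPow x p :=
  Measurable.ite measurableSet_Ioi (by fun_prop) measurable_const

theorem posPow_sq (x p : ℝ) : posPow x p ^ 2 = posPow x (2 * p) := by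
  unfold posPow
  split_ifs with h
  · rw [← Real.rpow_natCast, ← Real.rpow_mul h.le, mul_comm]; norm_num
  · simp

theorem rpow_sq {x : ℝ} (hx : 0 ≤ x) (p : ℝ) : (x ^ p) ^ 2 = x ^ (2 * p) := by
  rw [← Real.rpow_natCast, ← Real.rpow_mul hx, mul_comm]; norm_num

theorem intervalIntegrable_posPow {p : ℝ} (hp : -1 < p) (c d : ℝ) :
    IntervalIntegrable (fun x => posPow x p) volume c d := by
  have h := intervalIntegral.intervalIntegrable_rpow' (a := c) (b := d) hp
  have e : (fun x => posPow x p) = (Ioi 0).indicator fun x : ℝ => x ^ p := by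
    ext x; simp [posPow, indicator_apply]
  rw [e]
  exact ⟨h.1.indicator measurableSet_Ioi, h.2.indicator measurableSet_Ioi⟩

theorem integrableOn_posPow_sub {p : ℝ} (hp : -1 < p) (r c d : ℝ) :
    IntegrableOn (fun u => posPow (r - u) p) (Ioc c d) := by
  rcases le_total c d with h | h
  · have := (intervalIntegrable_posPow hp (r - c) (r - d)).comp_sub_left r
    simp only [sub_sub_cancel] at this
    rwa [intervalIntegrable_iff_integrableOn_Ioc_of_le h] at this
  · simp [Ioc_eq_empty_of_le h]

theorem memLp_posPow_sub {a : ℝ} (ha : -(1 / 2) < a) (r c d : ℝ) :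
    MemLp (fun u => posPow (r - u) a) 2 (volume.restrict (Ioc c d)) := by
  have hm : Measurable fun u => posPow (r - u) a :=
    (measurable_posPow a).comp (measurable_const.sub measurable_id)
  rw [memLp_two_iff_integrable_sq hm.aestronglyMeasurable]
  simp_rw [posPow_sq]
  exact integrableOn_posPow_sub (by linarith) r c d

theorem abs_rpow_add_sub_rpow_le {a v t : ℝ} (ha : a ≤ 1) (hv : 0 < v) (ht : 0 ≤ t) :
    |(t + v) ^ a - v ^ a| ≤ |a| * v ^ (a - 1) * t := by
  have := (convex_Icc (0 : ℝ) t).norm_image_sub_le_of_norm_hasDerivWithin_le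
    (f := fun r => (r + v) ^ a) (f' := fun r => a * (r + v) ^ (a - 1)) (C := |a| * v ^ (a - 1))
    (fun r hr => by
      have h1 : HasDerivAt (fun r : ℝ => r + v) 1 r := (hasDerivAt_id r).add_const v
      have := h1.rpow_const (p := a) (Or.inl (by linarith [hr.1] : r + v ≠ 0))
      exact (this.congr_deriv (by ring)).hasDerivWithinAt)
    (fun r hr => by
      rw [norm_mul, Real.norm_eq_abs, Real.norm_eq_abs,
        abs_of_pos (Real.rpow_pos_of_pos (by linarith [hr.1]) _)]
      exact mul_le_mul_of_nonneg_left
        (Real.rpow_le_rpow_of_nonpos hv (by linarith [hr.1]) (by linarith)) (abs_nonneg a))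
    (x := 0) (y := t) ⟨le_rfl, ht⟩ ⟨ht, le_rfl⟩
  simpa [abs_of_nonneg ht] using this

theorem integrableOn_Iic_neg_rpow {p s : ℝ} (hp : p < -1) (hs : 0 < s) :
    IntegrableOn (fun u : ℝ => (-u) ^ p) (Iic (-s)) := by
  have h := integrableOn_Ioi_rpow_of_lt hp hs
  have := ((Measure.measurePreserving_neg (volume : Measure ℝ)).integrableOn_comp_preimage
    (MeasurableEquiv.neg ℝ).measurableEmbedding).2 h
  rw [integrableOn_Iic_iff_integrableOn_Iio]
  simpa [Function.comp_def] using this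

theorem integral_Iic_neg_rpow {p s : ℝ} (hp : p < -1) (hs : 0 < s) :
    ∫ u in Iic (-s), (-u) ^ p = -s ^ (p + 1) / (p + 1) := by
  have := integral_comp_neg_Iic (-s) fun u : ℝ => u ^ p
  rw [this, neg_neg, integral_Ioi_rpow_of_lt hp hs]

theorem integrableOn_Ico_add_rpow {p : ℝ} (hp : -1 < p) (α β ρ : ℝ) :
    IntegrableOn (fun u : ℝ => (u + ρ) ^ p) (Ico α β) := by
  rcases le_total α β with h | h
  · have := (intervalIntegral.intervalIntegrable_rpow' (a := α + ρ) (b := β + ρ) hp).comp_add_right ρ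
    simp only [add_sub_cancel_right] at this
    rwa [intervalIntegrable_iff_integrableOn_Ico_of_le h] at this
  · simp [Ico_eq_empty_of_le h]

theorem integral_Ico_add_rpow_le {p α β ρ : ℝ} (hp : -1 < p) (hαβ : α ≤ β) (hρ : 0 ≤ α + ρ) :
    ∫ u in Ico α β, (u + ρ) ^ p ≤ (β + ρ) ^ (p + 1) / (p + 1) := by
  rw [integral_Ico_eq_integral_Ioc, ← intervalIntegral.integral_of_le hαβ,
    intervalIntegral.integral_comp_add_right (fun u : ℝ => u ^ p), integral_rpow (Or.inl hp)]
  have : 0 ≤ (α + ρ) ^ (p + 1) := Real.rpow_nonneg hρ _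
  exact div_le_div_of_nonneg_right (by linarith) (by linarith)

theorem integrableOn_Ico_sub_rpow {p : ℝ} (hp : -1 < p) (α β ρ : ℝ) :
    IntegrableOn (fun u : ℝ => (ρ - u) ^ p) (Ico α β) := by
  rcases le_total α β with h | h
  · have := (intervalIntegral.intervalIntegrable_rpow' (a := ρ - α) (b := ρ - β) hp).comp_sub_left ρ
    simp only [sub_sub_cancel] at this
    rwa [intervalIntegrable_iff_integrableOn_Ico_of_le h] at this
  · simp [Ico_eq_empty_of_le h]

theorem integral_Ico_sub_rpow_le {p α β ρ : ℝ} (hp : -1 < p) (hαβ : α ≤ β) (hρ : β ≤ ρ) :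
    ∫ u in Ico α β, (ρ - u) ^ p ≤ (ρ - α) ^ (p + 1) / (p + 1) := by
  rw [integral_Ico_eq_integral_Ioc, ← intervalIntegral.integral_of_le hαβ,
    intervalIntegral.integral_comp_sub_left (fun u : ℝ => u ^ p), integral_rpow (Or.inl hp)]
  have : 0 ≤ (ρ - β) ^ (p + 1) := Real.rpow_nonneg (by linarith) _
  exact div_le_div_of_nonneg_right (by linarith) (by linarith)

end KernelBounds

/-! ### Square integrability of the two kernels. -/

section KernelMemLp

open MeasureTheory Set

variable {H : ℝ}

theorem measurable_fKernel (H t : ℝ) : Measurable (fKernel H t) :=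
  (((measurable_posPow _).comp (measurable_const.sub measurable_id)).sub
    ((measurable_posPow _).comp measurable_id.neg)).const_mul _

theorem fKernel_zero (H u : ℝ) : fKernel H 0 u = 0 := by simp [fKernel]

theorem fKernel_neg (H t u : ℝ) : fKernel H (-t) u = -fKernel H t (u + t) := by
  simp only [fKernel]
  rw [show t - (u + t) = -u by ring, show -(u + t) = -t - u by ring]
  ring

/-- At `-∞` the two powers cancel to order `(-u) ^ (H - 3/2)`; the singularities at `0` and `t` have
exponent `H - 1/2 > -1/2`. -/
theorem memLp_fKernel_of_pos (hH₀ : 0 < H) (hH₁ : H < 1) {t : ℝ} (ht : 0 < t) :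
    MemLp (fKernel H t) 2 volume := by
  have hm := measurable_fKernel H t
  rw [memLp_two_iff_integrable_sq hm.aestronglyMeasurable]
  have h1 : IntegrableOn (fun u => fKernel H t u ^ 2) (Iic (-1)) := by
    refine Integrable.mono' (((integrableOn_Iic_neg_rpow (p := 2 * (H - 1 / 2 - 1)) (s := 1)
      (by linarith) one_pos).const_mul ((CMvN H * (|H - 1 / 2| * t)) ^ 2)))
      (hm.pow_const 2).aestronglyMeasurable ?_
    filter_upwards [ae_restrict_mem measurableSet_Iic] with u hu
    have hu' : 0 < -u := by linarith [mem_Iic.1 hu]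
    rw [Real.norm_eq_abs, abs_of_nonneg (sq_nonneg _), fKernel, posPow_of_pos (by linarith),
      posPow_of_pos hu', ← rpow_sq hu'.le, ← mul_pow, sq_le_sq, abs_mul, abs_mul, abs_mul]
    have h := abs_rpow_add_sub_rpow_le (a := H - 1 / 2) (by linarith) hu' ht.le
    rw [← sub_eq_add_neg] at h
    rw [mul_assoc |CMvN H|]
    refine mul_le_mul_of_nonneg_left (h.trans (le_of_eq ?_)) (abs_nonneg _)
    rw [abs_of_nonneg (by positivity : 0 ≤ |H - 1 / 2| * t),
      abs_of_pos (Real.rpow_pos_of_pos hu' _)]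
    ring
  have h2 : IntegrableOn (fun u => fKernel H t u ^ 2) (Ioc (-1) t) := by
    have h := ((memLp_posPow_sub (by linarith : -(1 / 2) < H - 1 / 2) t (-1) t).sub
      (memLp_posPow_sub (by linarith : -(1 / 2) < H - 1 / 2) 0 (-1) t)).const_mul (CMvN H)
    refine Integrable.congr h.integrable_sq (Filter.Eventually.of_forall fun u => ?_)
    simp [fKernel]
  have h3 : IntegrableOn (fun u => fKernel H t u ^ 2) (Ioi t) := by
    refine integrableOn_zero.congr_fun (fun u hu => ?_) measurableSet_Ioi
    have hu' := mem_Ioi.1 hu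
    simp [fKernel, posPow_of_nonpos (by linarith : t - u ≤ 0),
      posPow_of_nonpos (by linarith : -u ≤ 0)]
  rw [← integrableOn_univ, ← Iic_union_Ioi (a := t),
    ← Iic_union_Ioc_eq_Iic (by linarith : (-1 : ℝ) ≤ t)]
  exact (h1.union h2).union h3

theorem memLp_fKernel (hH₀ : 0 < H) (hH₁ : H < 1) (t : ℝ) : MemLp (fKernel H t) 2 volume := by
  rcases lt_trichotomy t 0 with h | rfl | h
  · have := ((memLp_fKernel_of_pos hH₀ hH₁ (neg_pos.2 h)).comp_measurePreserving
      (measurePreserving_add_right volume (-t))).neg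
    refine this.congr_norm (measurable_fKernel H t).aestronglyMeasurable
      (Filter.Eventually.of_forall fun u => ?_)
    have := fKernel_neg H (-t) u
    rw [neg_neg] at this
    simp [this]
  · have : fKernel H 0 = 0 := funext (fKernel_zero H)
    rw [this]
    exact MemLp.zero
  · exact memLp_fKernel_of_pos hH₀ hH₁ h

theorem zKernel_of_mem {t u : ℝ} (h0 : 0 < u) (ht : u < t) :
    zKernel H t u = cMG H * ((t - u) ^ (H - 1 / 2) * mgFun (H - 1 / 2) ((t - u) / u)) := by
  rw [zKernel, if_pos ⟨h0, ht⟩, mgFun, mul_assoc, ← neg_div, neg_sub, neg_sub]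
  ring_nf

theorem zKernel_of_le {t u : ℝ} (ht : t ≤ u) : zKernel H t u = 0 :=
  if_neg fun h => ht.not_gt h.2

theorem zKernel_of_nonpos {t u : ℝ} (hu : u ≤ 0) : zKernel H t u = 0 :=
  if_neg fun h => hu.not_gt h.1

theorem zKernel_eq_indicator (H t : ℝ) : zKernel H t = (Ioo 0 t).indicator
    fun u => cMG H * ((t - u) ^ (H - 1 / 2) * mgFun (H - 1 / 2) ((t - u) / u)) := by
  ext u
  by_cases h : u ∈ Ioo 0 t
  · rw [indicator_of_mem h, zKernel_of_mem h.1 h.2]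
  · rw [indicator_of_notMem h]; exact if_neg h

/-- One of `x`, `y` lies in `[t/2, t]`, where its power is bounded. The product of two endpoint
singularities is thus separated into a sum. -/
theorem mul_rpow_le_add {x y t : ℝ} (p q : ℝ) (hx : 0 < x) (hy : 0 < y) (h : x + y = t) :
    x ^ p * y ^ q ≤ ((t / 2) ^ q + t ^ q) * x ^ p + ((t / 2) ^ p + t ^ p) * y ^ q := by
  have key : ∀ z r : ℝ, t / 2 ≤ z → z ≤ t → z ^ r ≤ (t / 2) ^ r + t ^ r := by
    intro z r h1 h2
    have ht2 : 0 < t / 2 := by linarith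
    rcases le_total 0 r with hr | hr
    · linarith [Real.rpow_le_rpow (by linarith) h2 hr, Real.rpow_nonneg ht2.le r]
    · linarith [Real.rpow_le_rpow_of_nonpos ht2 h1 hr, Real.rpow_nonneg (by linarith : 0 ≤ t) r]
  have ht : 0 < t := by linarith
  have hxp : 0 < x ^ p := by positivity
  have hyq : 0 < y ^ q := by positivity
  have hA : 0 < (t / 2) ^ q + t ^ q := by positivity
  have hB : 0 < (t / 2) ^ p + t ^ p := by positivity
  rcases le_total x y with hxy | hxy
  · nlinarith [key y q (by linarith) (by linarith)]
  · nlinarith [key x p (by linarith) (by linarith)]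

theorem aestronglyMeasurable_zKernel (hH₀ : 0 < H) (t : ℝ) :
    AEStronglyMeasurable (zKernel H t) volume := by
  rw [zKernel_eq_indicator, aestronglyMeasurable_indicator_iff measurableSet_Ioo]
  refine ContinuousOn.aestronglyMeasurable (fun u hu => ?_) measurableSet_Ioo
  have h0 : 0 < t - u := by linarith [hu.2]
  have h1 : ContinuousAt (fun u : ℝ => (t - u) ^ (H - 1 / 2)) u :=
    (continuousAt_const.sub continuousAt_id).rpow_const (Or.inl h0.ne')
  have h2 : ContinuousAt (fun u : ℝ => mgFun (H - 1 / 2) ((t - u) / u)) u :=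
    ContinuousAt.comp (f := fun u : ℝ => (t - u) / u) (g := mgFun (H - 1 / 2))
      (mgFun_analyticAt (by linarith) (by linarith [div_pos h0 hu.1])).continuousAt
      ((continuousAt_const.sub continuousAt_id).div continuousAt_id hu.1.ne')
  exact (continuousAt_const.mul (h1.mul h2)).continuousWithinAt

theorem memLp_zKernel (hH₀ : 0 < H) (hH₁ : H < 1) (t : ℝ) : MemLp (zKernel H t) 2 volume := by
  have hm := aestronglyMeasurable_zKernel hH₀ t
  rcases le_or_gt t 0 with ht | ht
  · have : zKernel H t = 0 := by
      ext u
      exact if_neg fun h => by linarith [h.1, h.2]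
    rw [this]
    exact MemLp.zero
  have ha : |H - 1 / 2| < 1 / 2 := abs_lt.2 ⟨by linarith, by linarith⟩
  -- With `b < 1/2` the growth bound, of order `(t / u) ^ b`, is square integrable at `u = 0`.
  obtain ⟨b, hab, hb⟩ := exists_between ha
  obtain ⟨C, hC, hbound⟩ := exists_abs_mgFun_le (by linarith : -1 < H - 1 / 2) (by linarith) hab
  rw [memLp_two_iff_integrable_sq hm]
  set p := 2 * (H - 1 / 2) with hp
  set q := 2 * (-b) with hq
  set K := (cMG H * C * t ^ b) ^ 2 with hK
  have hint : IntegrableOn (fun u : ℝ => K * (((t / 2) ^ q + t ^ q) * (t - u) ^ p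
      + ((t / 2) ^ p + t ^ p) * (u + 0) ^ q)) (Ico 0 t) :=
    (((integrableOn_Ico_sub_rpow (by linarith) 0 t t).const_mul _).add
      ((integrableOn_Ico_add_rpow (by linarith) 0 t 0).const_mul _)).const_mul _
  refine Integrable.mono' (hint.integrable_indicator measurableSet_Ico) (hm.pow 2)
    (Filter.Eventually.of_forall fun u => ?_)
  rw [Real.norm_eq_abs, abs_of_nonneg (sq_nonneg _)]
  by_cases hu : u ∈ Ioo 0 t
  · rw [indicator_of_mem (show u ∈ Ico 0 t from ⟨hu.1.le, hu.2⟩), zKernel_of_mem hu.1 hu.2, add_zero]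
    have h0 : 0 < t - u := by linarith [hu.2]
    have hu0 := hu.1
    refine le_trans ?_ (mul_le_mul_of_nonneg_left
      (mul_rpow_le_add p q h0 hu.1 (by ring)) (sq_nonneg _))
    rw [hp, hq, ← rpow_sq h0.le, ← rpow_sq hu.1.le, ← mul_pow, hK, ← mul_pow, sq_le_sq]
    have hb := hbound ((t - u) / u) (div_nonneg h0.le hu.1.le)
    rw [show 1 + (t - u) / u = t / u by field_simp; ring, Real.div_rpow ht.le hu.1.le] at hb
    simp only [abs_mul]
    rw [abs_of_pos hC, abs_of_pos (by positivity : 0 < t ^ b),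
      abs_of_pos (by positivity : 0 < (t - u) ^ (H - 1 / 2)),
      abs_of_pos (by positivity : 0 < u ^ (-b)), Real.rpow_neg hu.1.le]
    calc |cMG H| * ((t - u) ^ (H - 1 / 2) * |mgFun (H - 1 / 2) ((t - u) / u)|)
        ≤ |cMG H| * ((t - u) ^ (H - 1 / 2) * (C * (t ^ b / u ^ b))) := by gcongr
      _ = _ := by ring
  · have : zKernel H t u = 0 := if_neg hu
    rw [this, zero_pow two_ne_zero]
    refine indicator_nonneg (fun v hv => ?_) u
    have h1 : 0 ≤ t - v := by linarith [hv.2]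
    have h2 : 0 ≤ v + 0 := by linarith [hv.1]
    have := ht.le
    positivity

end KernelMemLp

/-! ### Pointwise bounds for the kernel of the error. -/

section KernelDifference

open MeasureTheory Set

/-- The kernel of `Z^s_t - Z^∞_t` with respect to the driving process. -/
noncomputable def kernelDiff (H s t u : ℝ) : ℝ :=
  zKernel H (t + s) (u + s) - zKernel H s (u + s) - cMG H / CMvN H * fKernel H t u

theorem CMvN_pos {H : ℝ} (hH : 0 < H) : 0 < CMvN H := by
  have h : 0 ≤ ∫ s in Set.Ioi (0 : ℝ), ((1 + s) ^ (H - 1 / 2) - s ^ (H - 1 / 2)) ^ 2 :=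
    integral_nonneg fun _ => sq_nonneg _
  exact Real.rpow_pos_of_pos (by positivity) _

/-- The factor `c_H / C_H` puts the same constant in front of both kernels, which allows their
leading terms to cancel. -/
theorem kernelDiff_eq {H : ℝ} (hH : 0 < H) (s t u : ℝ) :
    kernelDiff H s t u = zKernel H (t + s) (u + s) - zKernel H s (u + s)
      - cMG H * (posPow (t - u) (H - 1 / 2) - posPow (-u) (H - 1 / 2)) := by
  have := (CMvN_pos hH).ne'
  rw [kernelDiff, fKernel]
  field_simp

theorem memLp_kernelDiff {H : ℝ} (hH₀ : 0 < H) (hH₁ : H < 1) (s t : ℝ) :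
    MemLp (kernelDiff H s t) 2 volume :=
  (((memLp_zKernel hH₀ hH₁ (t + s)).comp_measurePreserving
    (measurePreserving_add_right volume s)).sub
    ((memLp_zKernel hH₀ hH₁ s).comp_measurePreserving
      (measurePreserving_add_right volume s))).sub ((memLp_fKernel hH₀ hH₁ t).const_mul _)

/-- The left side is the increment over `r ∈ [0, t]` of a function whose derivative is explicit by
`hasDerivAt_rpow_mul_mgFun_sub_one`, so the mean value inequality applies. The `-1` gives the
derivative a factor that is small when `(r - u) / (u + s)` is. -/
theorem abs_mgDiff_le {a s t u M : ℝ} (ha : -1 < a) (hs : -s < u) (hu : u < 0) (ht : 0 ≤ t)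
    (hM : ∀ r ∈ Icc 0 t,
      |a| * (r - u) ^ (a - 1) * |(1 + (r - u) / (u + s)) ^ a - 1| ≤ M) :
    |(t - u) ^ a * (mgFun a ((t - u) / (u + s)) - 1)
      - (-u) ^ a * (mgFun a (-u / (u + s)) - 1)| ≤ M * t := by
  have hx : 0 < u + s := by linarith
  have hpos : ∀ r ∈ Icc 0 t, 0 < r - u := fun r hr => by linarith [hr.1]
  have hder : ∀ r ∈ Icc 0 t, HasDerivAt (fun r => (u + s) ^ a *
      (((r - u) / (u + s)) ^ a * (mgFun a ((r - u) / (u + s)) - 1)))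
      (a * (r - u) ^ (a - 1) * ((1 + (r - u) / (u + s)) ^ a - 1)) r := by
    intro r hr
    have h1 := hpos r hr
    have h2 : HasDerivAt (fun r => (r - u) / (u + s)) (1 / (u + s)) r :=
      ((hasDerivAt_id r).sub_const u).div_const _
    have h3 := ((hasDerivAt_rpow_mul_mgFun_sub_one ha (div_pos h1 hx)).comp r h2).const_mul
      ((u + s) ^ a)
    refine h3.congr_deriv ?_
    rw [Real.div_rpow h1.le hx.le (a - 1), Real.rpow_sub_one hx.ne' a]
    have : (u + s) ^ a ≠ 0 := by positivity
    field_simp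
  have := (convex_Icc (0 : ℝ) t).norm_image_sub_le_of_norm_hasDerivWithin_le (C := M)
    (fun r hr => (hder r hr).hasDerivWithinAt)
    (fun r hr => by
      rw [norm_mul, norm_mul, Real.norm_eq_abs, Real.norm_eq_abs, Real.norm_eq_abs,
        abs_of_pos (Real.rpow_pos_of_pos (hpos r hr) _)]
      exact hM r hr)
    (x := 0) (y := t) ⟨le_rfl, ht⟩ ⟨ht, le_rfl⟩
  -- Multiplying by `(u + s) ^ a` undoes the scaling `w = (r - u) / (u + s)`.
  have e : ∀ r ∈ Icc 0 t, (u + s) ^ a *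
      (((r - u) / (u + s)) ^ a * (mgFun a ((r - u) / (u + s)) - 1))
      = (r - u) ^ a * (mgFun a ((r - u) / (u + s)) - 1) := by
    intro r hr
    have : (u + s) ^ a ≠ 0 := by positivity
    rw [Real.div_rpow (hpos r hr).le hx.le]
    field_simp
  simp only [e t ⟨ht, le_rfl⟩, e 0 ⟨le_rfl, ht⟩] at this
  simpa [abs_of_nonneg ht] using this

variable {H s t u : ℝ}

theorem kernelDiff_of_ge (hH₀ : 0 < H) (ht : 0 ≤ t) (hu : t ≤ u) : kernelDiff H s t u = 0 := by
  rw [kernelDiff_eq hH₀, zKernel_of_le (by linarith), zKernel_of_le (by linarith),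
    posPow_of_nonpos (by linarith), posPow_of_nonpos (by linarith)]
  simp

theorem abs_kernelDiff_le_of_le (hH₀ : 0 < H) (hH₁ : H < 1) (ht : 0 ≤ t) (hs : 0 < s)
    (hu : u ≤ -s) :
    |kernelDiff H s t u| ≤ |cMG H| * |H - 1 / 2| * t * (-u) ^ (H - 1 / 2 - 1) := by
  have hu' : 0 < -u := by linarith
  have h := abs_rpow_add_sub_rpow_le (a := H - 1 / 2) (by linarith) hu' ht
  rw [kernelDiff_eq hH₀, zKernel_of_nonpos (by linarith), zKernel_of_nonpos (by linarith),
    posPow_of_pos (by linarith), posPow_of_pos hu', sub_zero, zero_sub, abs_neg, abs_mul]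
  rw [← sub_eq_add_neg] at h
  calc _ ≤ |cMG H| * (|H - 1 / 2| * (-u) ^ (H - 1 / 2 - 1) * t) := by gcongr
    _ = _ := by ring

theorem kernelDiff_of_mem_Ioo (hH₀ : 0 < H) (ht : 0 ≤ t) (hs : -s < u) (hu : u < 0) :
    kernelDiff H s t u = cMG H *
      ((t - u) ^ (H - 1 / 2) * (mgFun (H - 1 / 2) ((t - u) / (u + s)) - 1)
      - (-u) ^ (H - 1 / 2) * (mgFun (H - 1 / 2) (-u / (u + s)) - 1)) := by
  rw [kernelDiff_eq hH₀, zKernel_of_mem (by linarith) (by linarith),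
    zKernel_of_mem (by linarith) (by linarith), posPow_of_pos (by linarith),
    posPow_of_pos (by linarith), show t + s - (u + s) = t - u by ring,
    show s - (u + s) = -u by ring]
  ring

/-- Near `-s` the ratio `(r - u) / (u + s)` is not small and no cancellation is available; `1 + (r -
u) / (u + s) = (r + s) / (u + s) ≤ 2 s / (u + s)` bounds the factor crudely. -/
theorem abs_kernelDiff_le_left (hH₀ : 0 < H) (hH₁ : H < 1) (ht : 0 ≤ t) (hts : t ≤ s)
    (hs : -s < u) (hu : u < 0) :
    |kernelDiff H s t u| ≤ |cMG H| * |H - 1 / 2| * t * (-u) ^ (H - 1 / 2 - 1)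
      * ((2 * s / (u + s)) ^ |H - 1 / 2| + 1) := by
  rw [kernelDiff_of_mem_Ioo hH₀ ht hs hu, abs_mul]
  set a := H - 1 / 2 with ha
  have hx : 0 < u + s := by linarith
  have h := abs_mgDiff_le (a := a) (s := s) (t := t) (u := u)
    (M := |a| * (-u) ^ (a - 1) * ((2 * s / (u + s)) ^ |a| + 1)) (by linarith) hs hu ht (by
      intro r hr
      have h1 : 1 ≤ 1 + (r - u) / (u + s) := by
        have : 0 < r - u := by linarith [hr.1]
        linarith [div_pos this hx]
      have h2 : 1 + (r - u) / (u + s) ≤ 2 * s / (u + s) := by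
        rw [show 1 + (r - u) / (u + s) = (r + s) / (u + s) by field_simp; ring]
        exact div_le_div_of_nonneg_right (by linarith [hr.2]) hx.le
      have h3 : (1 + (r - u) / (u + s)) ^ a ≤ (2 * s / (u + s)) ^ |a| :=
        (Real.rpow_le_rpow_of_exponent_le h1 (le_abs_self a)).trans
          (Real.rpow_le_rpow (by linarith) h2 (abs_nonneg a))
      have h4 : (r - u) ^ (a - 1) ≤ (-u) ^ (a - 1) :=
        Real.rpow_le_rpow_of_nonpos (by linarith) (by linarith [hr.1]) (by linarith)
      have h5 : 0 ≤ (1 + (r - u) / (u + s)) ^ a := Real.rpow_nonneg (by linarith) _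
      have h6 : |(1 + (r - u) / (u + s)) ^ a - 1| ≤ (2 * s / (u + s)) ^ |a| + 1 :=
        abs_le.2 ⟨by linarith, by linarith⟩
      have h7 : 0 ≤ (-u) ^ (a - 1) := Real.rpow_nonneg (by linarith) _
      gcongr)
  calc _ ≤ |cMG H| * (|a| * (-u) ^ (a - 1) * ((2 * s / (u + s)) ^ |a| + 1) * t) := by gcongr
    _ = _ := by ring

/-- Here `u + s ≥ s / 2`, and the linear bound on `(1 + y) ^ a - 1` gains a factor `(r - u) / s`.
The sum of two powers avoids distinguishing the sign of `a` in the result. -/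
theorem abs_kernelDiff_le_right (hH₀ : 0 < H) (hH₁ : H < 1) (ht : 0 ≤ t)
    (hs0 : 0 < s) (hs : -(s / 2) ≤ u) (hu : u < 0) :
    |kernelDiff H s t u| ≤ 2 * |cMG H| * t * s⁻¹ * ((-u) ^ (H - 1 / 2) + (t - u) ^ (H - 1 / 2)) := by
  rw [kernelDiff_of_mem_Ioo hH₀ ht (by linarith) hu, abs_mul]
  set a := H - 1 / 2 with ha
  have hx : 0 < u + s := by linarith
  have ha1 : |a| ≤ 1 := abs_le.2 ⟨by linarith, by linarith⟩
  have h := abs_mgDiff_le (a := a) (s := s) (t := t) (u := u)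
    (M := 2 * s⁻¹ * ((-u) ^ a + (t - u) ^ a)) (by linarith) (by linarith) hu ht (by
      intro r hr
      have h0 : 0 < r - u := by linarith [hr.1]
      have h1 := abs_rpow_one_add_sub_one_le (a := a) (y := (r - u) / (u + s)) ha1 (by positivity)
      have h2 : (r - u) ^ a ≤ (-u) ^ a + (t - u) ^ a := by
        have p1 : 0 ≤ (-u) ^ a := Real.rpow_nonneg (by linarith) _
        have p2 : 0 ≤ (t - u) ^ a := Real.rpow_nonneg (by linarith) _
        rcases le_total 0 a with h | h
        · linarith [Real.rpow_le_rpow h0.le (by linarith [hr.2] : r - u ≤ t - u) h]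
        · linarith [Real.rpow_le_rpow_of_nonpos (by linarith) (by linarith [hr.1] : -u ≤ r - u) h]
      have h3 : (u + s)⁻¹ ≤ 2 * s⁻¹ := by
        rw [← inv_inv (2 : ℝ), ← mul_inv]
        exact inv_anti₀ (by positivity) (by linarith)
      have e : (r - u) ^ a = (r - u) ^ (a - 1) * (r - u) := by
        rw [Real.rpow_sub_one h0.ne']; field_simp
      calc |a| * (r - u) ^ (a - 1) * |(1 + (r - u) / (u + s)) ^ a - 1|
          ≤ 1 * (r - u) ^ (a - 1) * (1 * ((r - u) / (u + s))) := by
            gcongr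
            exact h1.trans (by gcongr)
        _ = (u + s)⁻¹ * (r - u) ^ a := by rw [e]; ring
        _ ≤ _ := by gcongr)
  calc _ ≤ |cMG H| * (2 * s⁻¹ * ((-u) ^ a + (t - u) ^ a) * t) := by gcongr
    _ = _ := by ring

/-- The terms at time `0` vanish, and the argument of `mgFun` is at most `t / s ≤ 1`, where `mgFun`
differs from `1` linearly. -/
theorem abs_kernelDiff_le_of_nonneg (hH₀ : 0 < H) {C : ℝ}
    (hC : ∀ w, 0 ≤ w → w ≤ 1 → |mgFun (H - 1 / 2) w - 1| ≤ C * w) (hC0 : 0 < C)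
    (ht : 0 < t) (hts : t ≤ s) (hu : 0 ≤ u) (hut : u < t) :
    |kernelDiff H s t u| ≤ |cMG H| * C * t ^ (H + 1 / 2) * s⁻¹ := by
  have h0 : 0 < t - u := by linarith
  have hx : 0 < u + s := by linarith
  rw [kernelDiff_eq hH₀, zKernel_of_mem (by linarith) (by linarith), zKernel_of_le (by linarith),
    posPow_of_pos h0, posPow_of_nonpos (by linarith), show t + s - (u + s) = t - u by ring]
  have h1 := hC ((t - u) / (u + s)) (by positivity) ((div_le_one hx).2 (by linarith))
  have e : (t - u) ^ (H + 1 / 2) = (t - u) ^ (H - 1 / 2) * (t - u) := by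
    rw [← Real.rpow_add_one h0.ne']; ring_nf
  calc _ = |cMG H| * ((t - u) ^ (H - 1 / 2) * |mgFun (H - 1 / 2) ((t - u) / (u + s)) - 1|) := by
        rw [← abs_of_pos (by positivity : 0 < (t - u) ^ (H - 1 / 2)), ← abs_mul, ← abs_mul,
          abs_of_pos (by positivity : 0 < (t - u) ^ (H - 1 / 2))]
        ring_nf
    _ ≤ |cMG H| * ((t - u) ^ (H - 1 / 2) * (C * ((t - u) / (u + s)))) := by gcongr
    _ = |cMG H| * C * (t - u) ^ (H + 1 / 2) * (u + s)⁻¹ := by rw [e]; ring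
    _ ≤ _ := by
      gcongr <;> linarith

theorem kernelDiff_sq_le_of_le (hH₀ : 0 < H) (hH₁ : H < 1) (ht : 0 ≤ t) (hs : 0 < s)
    (hu : u ≤ -s) :
    kernelDiff H s t u ^ 2 ≤ (|cMG H| * |H - 1 / 2| * t) ^ 2 * (-u) ^ (2 * (H - 1 / 2 - 1)) := by
  rw [← sq_abs, ← rpow_sq (by linarith : 0 ≤ -u), ← mul_pow]
  exact pow_le_pow_left₀ (abs_nonneg _) (abs_kernelDiff_le_of_le hH₀ hH₁ ht hs hu) 2

theorem kernelDiff_sq_le_left (hH₀ : 0 < H) (hH₁ : H < 1) (ht : 0 ≤ t) (hts : t ≤ s)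
    (hs : -s < u) (hs0 : 0 < s) (hu : u < -(s / 2)) :
    kernelDiff H s t u ^ 2 ≤ 2 * (|cMG H| * |H - 1 / 2| * t) ^ 2
      * (s / 2) ^ (2 * (H - 1 / 2 - 1))
      * ((2 * s) ^ (2 * |H - 1 / 2|) * (u + s) ^ (-(2 * |H - 1 / 2|)) + 1) := by
  have h0 : 0 < -u := by linarith
  have hx : 0 < u + s := by linarith
  rw [← sq_abs]
  refine (pow_le_pow_left₀ (abs_nonneg _)
    (abs_kernelDiff_le_left hH₀ hH₁ ht hts hs (by linarith)) 2).trans ?_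
  rw [mul_pow, mul_pow _ ((-u) ^ (H - 1 / 2 - 1)), rpow_sq h0.le]
  have r1 : (-u) ^ (2 * (H - 1 / 2 - 1)) ≤ (s / 2) ^ (2 * (H - 1 / 2 - 1)) :=
    Real.rpow_le_rpow_of_nonpos (by linarith) (by linarith) (by linarith)
  have r2 : ((2 * s / (u + s)) ^ |H - 1 / 2| + 1) ^ 2
      ≤ 2 * ((2 * s) ^ (2 * |H - 1 / 2|) * (u + s) ^ (-(2 * |H - 1 / 2|)) + 1) := by
    refine add_sq_le.trans (le_of_eq ?_)
    rw [rpow_sq (by positivity), one_pow, Real.div_rpow (by positivity) hx.le,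
      Real.rpow_neg hx.le]
    rfl
  calc _ ≤ (|cMG H| * |H - 1 / 2| * t) ^ 2 * (s / 2) ^ (2 * (H - 1 / 2 - 1)) *
        (2 * ((2 * s) ^ (2 * |H - 1 / 2|) * (u + s) ^ (-(2 * |H - 1 / 2|)) + 1)) := by gcongr
    _ = _ := by ring

theorem kernelDiff_sq_le_right (hH₀ : 0 < H) (hH₁ : H < 1) (ht : 0 ≤ t)
    (hs0 : 0 < s) (hs : -(s / 2) ≤ u) (hu : u < 0) :
    kernelDiff H s t u ^ 2 ≤ 2 * (2 * |cMG H| * t) ^ 2 * (s⁻¹) ^ 2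
      * ((0 - u) ^ (2 * (H - 1 / 2)) + (t - u) ^ (2 * (H - 1 / 2))) := by
  rw [← sq_abs]
  refine (pow_le_pow_left₀ (abs_nonneg _)
    (abs_kernelDiff_le_right hH₀ hH₁ ht hs0 hs hu) 2).trans ?_
  rw [mul_pow, mul_pow _ (s⁻¹)]
  have r := add_sq_le (a := (-u) ^ (H - 1 / 2)) (b := (t - u) ^ (H - 1 / 2))
  rw [rpow_sq (by linarith), rpow_sq (by linarith)] at r
  rw [zero_sub]
  calc _ ≤ (2 * |cMG H| * t) ^ 2 * s⁻¹ ^ 2 *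
        (2 * ((-u) ^ (2 * (H - 1 / 2)) + (t - u) ^ (2 * (H - 1 / 2)))) := by gcongr
    _ = _ := by ring

theorem kernelDiff_sq_le_of_nonneg (hH₀ : 0 < H) {C : ℝ}
    (hC : ∀ w, 0 ≤ w → w ≤ 1 → |mgFun (H - 1 / 2) w - 1| ≤ C * w) (hC0 : 0 < C)
    (ht : 0 < t) (hts : t ≤ s) (hu : 0 ≤ u) (hut : u < t) :
    kernelDiff H s t u ^ 2 ≤ (|cMG H| * C * t ^ (H + 1 / 2)) ^ 2 * (s⁻¹) ^ 2 := by
  rw [← sq_abs, ← mul_pow]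
  exact pow_le_pow_left₀ (abs_nonneg _)
    (abs_kernelDiff_le_of_nonneg hH₀ hC hC0 ht hts hu hut) 2

end KernelDifference

/-! ### The rate `s ^ (2 * H - 2)` for the squared norm of the kernel difference. -/

section KernelDifferenceIntegral

open MeasureTheory Set

-- The squared pointwise bounds are integrated over `u ≤ -s`, `[-s, -s/2)`, `[-s/2, 0)` and `[0,
-- t)`, giving the constants `K₁` to `K₄` in that order. The first three integrals scale exactly as
-- `s ^ (2 * H - 2)`, up to lower-order shifts by `t ≤ s`.
set_option maxHeartbeats 1000000 in
theorem exists_integral_kernelDiff_sq_le_of_pos {H t : ℝ} (hH₀ : 0 < H) (hH₁ : H < 1)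
    (ht : 0 < t) :
    ∃ C, 0 < C ∧ ∀ s, t ≤ s → 1 ≤ s →
      ∫ u, kernelDiff H s t u ^ 2 ≤ C * s ^ (2 * H - 2) := by
  obtain ⟨C₀, hC₀, hC⟩ := exists_abs_mgFun_sub_one_le (a := H - 1 / 2) (by linarith)
  set a := H - 1 / 2 with ha
  have ha2 : |a| < 1 / 2 := abs_lt.2 ⟨by linarith, by linarith⟩
  set q := 2 * |a| with hq
  have hq1 : 0 < 1 - q := by linarith
  have hH2 : 0 < 2 * H := by linarith
  have hp1 : 2 * (a - 1) < -1 := by linarith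
  set A := (|cMG H| * |a| * t) ^ 2 with hA
  set B := (2 * |cMG H| * t) ^ 2 with hB
  set D := (|cMG H| * C₀ * t ^ (H + 1 / 2)) ^ 2 with hD
  set K₁ := A / (2 - 2 * H) with hK₁
  set K₂ := 2 * A * (2⁻¹ : ℝ) ^ (2 * (a - 1)) * (1 + 2 ^ q / (1 - q)) with hK₂
  set K₃ := 4 * B * 2 ^ (2 * H) / (2 * H) with hK₃
  set K₄ := D * t with hK₄
  have hA0 : 0 ≤ A := sq_nonneg _
  have hB0 : 0 ≤ B := sq_nonneg _
  have hD0 : 0 ≤ D := sq_nonneg _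
  have h22 : 0 < 2 - 2 * H := by linarith
  -- The added `1` keeps the constant positive when the `K`'s vanish.
  refine ⟨K₁ + K₂ + K₃ + K₄ + 1, by positivity, fun s hts hs => ?_⟩
  have hs0 : 0 < s := by linarith
  set g₁ : ℝ → ℝ := fun u => A * (-u) ^ (2 * (a - 1)) with hg₁
  set g₂ : ℝ → ℝ := fun u => 2 * A * (s / 2) ^ (2 * (a - 1)) * ((2 * s) ^ q * (u + s) ^ (-q) + 1)
    with hg₂
  set g₃ : ℝ → ℝ := fun u => 2 * B * (s⁻¹) ^ 2 * ((0 - u) ^ (2 * a) + (t - u) ^ (2 * a)) with hg₃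
  set g₄ : ℝ → ℝ := fun u => D * (s⁻¹) ^ 2 with hg₄
  have i₁ : IntegrableOn g₁ (Iic (-s)) := (integrableOn_Iic_neg_rpow hp1 hs0).const_mul _
  have i₂' : IntegrableOn (fun u : ℝ => (2 * s) ^ q * (u + s) ^ (-q)) (Ico (-s) (-(s / 2))) :=
    (integrableOn_Ico_add_rpow (by linarith) _ _ _).const_mul _
  have i₂'' : IntegrableOn (fun _ : ℝ => (1 : ℝ)) (Ico (-s) (-(s / 2))) := by simp
  have i₂ : IntegrableOn g₂ (Ico (-s) (-(s / 2))) := (i₂'.add i₂'').const_mul _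
  have i₃' : ∀ ρ, IntegrableOn (fun u : ℝ => (ρ - u) ^ (2 * a)) (Ico (-(s / 2)) 0) :=
    fun ρ => integrableOn_Ico_sub_rpow (by linarith) _ _ ρ
  have i₃ : IntegrableOn g₃ (Ico (-(s / 2)) 0) := ((i₃' 0).add (i₃' t)).const_mul _
  have i₄ : IntegrableOn g₄ (Ico 0 t) := integrableOn_const (by simp)
  have e1 : s ^ (2 * (a - 1)) * s = s ^ (2 * H - 2) := by
    rw [← Real.rpow_add_one hs0.ne']; congr 1; rw [ha]; ring
  have e2 : (s⁻¹) ^ 2 * s ^ (2 * H) = s ^ (2 * H - 2) := by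
    rw [Real.rpow_sub hs0, inv_pow]; norm_num; ring
  have b₁ : ∫ u in Iic (-s), g₁ u ≤ K₁ * s ^ (2 * H - 2) := by
    rw [hg₁, integral_const_mul, integral_Iic_neg_rpow hp1 hs0, hK₁, Real.rpow_add_one hs0.ne', e1,
      show 2 * (a - 1) + 1 = -(2 - 2 * H) by rw [ha]; ring, neg_div_neg_eq]
    exact le_of_eq (by ring)
  have b₂ : ∫ u in Ico (-s) (-(s / 2)), g₂ u ≤ K₂ * s ^ (2 * H - 2) := by
    have h1 := integral_Ico_add_rpow_le (p := -q) (α := -s) (β := -(s / 2)) (ρ := s) (by linarith)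
      (by linarith) (by linarith)
    have h2 : (-(s / 2) + s) ^ (-q + 1) ≤ s ^ (-q + 1) :=
      Real.rpow_le_rpow (by linarith) (by linarith) (by linarith)
    have h3 : ∫ u in Ico (-s) (-(s / 2)), (u + s) ^ (-q) ≤ s ^ (-q + 1) / (1 - q) := by
      refine h1.trans ?_
      rw [show -q + 1 = 1 - q by ring] at h2 ⊢
      gcongr
    have h4 : s ^ q * s ^ (-q + 1) = s := by
      rw [← Real.rpow_add hs0]; simp
    rw [hg₂, integral_const_mul, integral_add i₂' i₂'', integral_const_mul]
    have h5 : ∫ _ in Ico (-s) (-(s / 2)), (1 : ℝ) ≤ s := by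
      rw [setIntegral_const]
      simp
      constructor <;> linarith
    calc _ ≤ 2 * A * (s / 2) ^ (2 * (a - 1)) * ((2 * s) ^ q * (s ^ (-q + 1) / (1 - q)) + s) := by
          gcongr
      _ = K₂ * (s ^ (2 * (a - 1)) * s) := by
          rw [hK₂, Real.mul_rpow (by norm_num) hs0.le, div_eq_mul_inv s,
            Real.mul_rpow hs0.le (by norm_num)]
          linear_combination 2 * A * (s ^ (2 * (a - 1)) * 2⁻¹ ^ (2 * (a - 1))) * 2 ^ q / (1 - q) * h4
      _ = _ := by rw [e1]
  have b₃ : ∫ u in Ico (-(s / 2)) 0, g₃ u ≤ K₃ * s ^ (2 * H - 2) := by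
    -- The shifts `ρ = 0` and `ρ = t` are needed; `ρ + s / 2 ≤ 2 s` covers both.
    have h : ∀ ρ, 0 ≤ ρ → ρ ≤ s → ∫ u in Ico (-(s / 2)) 0, (ρ - u) ^ (2 * a)
        ≤ (2 * s) ^ (2 * H) / (2 * H) := by
      intro ρ h0 h1
      refine (integral_Ico_sub_rpow_le (by linarith) (by linarith) h0).trans ?_
      rw [show 2 * a + 1 = 2 * H by rw [ha]; ring]
      gcongr
      · linarith
      · linarith
    rw [hg₃, integral_const_mul, integral_add (i₃' 0) (i₃' t)]
    calc _ ≤ 2 * B * s⁻¹ ^ 2 * ((2 * s) ^ (2 * H) / (2 * H) + (2 * s) ^ (2 * H) / (2 * H)) := by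
          have := h 0 le_rfl hs0.le
          have := h t ht.le hts
          gcongr
      _ = K₃ * (s⁻¹ ^ 2 * s ^ (2 * H)) := by
          rw [hK₃, Real.mul_rpow (by norm_num) hs0.le]; ring
      _ = _ := by rw [e2]
  have b₄ : ∫ u in Ico 0 t, g₄ u ≤ K₄ * s ^ (2 * H - 2) := by
    rw [hg₄, setIntegral_const, ← e2]
    simp only [smul_eq_mul, Measure.real, Real.volume_Ico, sub_zero, ENNReal.toReal_ofReal ht.le]
    -- On `[0, t)` the true order is `s⁻²`, weakened to `s ^ (2 * H - 2)` by `s ≥ 1`.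
    have : 1 ≤ s ^ (2 * H) := Real.one_le_rpow hs hH2.le
    have h0 : 0 ≤ t * D * s⁻¹ ^ 2 := by positivity
    rw [hK₄]
    nlinarith
  have n₁ : 0 ≤ (Iic (-s)).indicator g₁ := fun u => indicator_nonneg (fun v hv => by
    have : 0 ≤ -v := by linarith [mem_Iic.1 hv]
    positivity) u
  have n₂ : 0 ≤ (Ico (-s) (-(s / 2))).indicator g₂ := fun u => indicator_nonneg (fun v hv => by
    have : 0 ≤ v + s := by linarith [hv.1]
    positivity) u
  have n₃ : 0 ≤ (Ico (-(s / 2)) 0).indicator g₃ := fun u => indicator_nonneg (fun v hv => by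
    have h1 : 0 ≤ 0 - v := by linarith [hv.2]
    have h2 : 0 ≤ t - v := by linarith [hv.2]
    positivity) u
  have n₄ : 0 ≤ (Ico 0 t).indicator g₄ := fun u => indicator_nonneg (fun v hv => by positivity) u
  have key : ∀ u, kernelDiff H s t u ^ 2 ≤ (Iic (-s)).indicator g₁ u
      + (Ico (-s) (-(s / 2))).indicator g₂ u + (Ico (-(s / 2)) 0).indicator g₃ u
      + (Ico 0 t).indicator g₄ u := by
    intro u
    have m₁ := n₁ u
    have m₂ := n₂ u
    have m₃ := n₃ u
    have m₄ := n₄ u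
    simp only [Pi.zero_apply] at m₁ m₂ m₃ m₄
    rcases le_or_gt u (-s) with c1 | c1
    · rw [indicator_of_mem (show u ∈ Iic (-s) from c1)] at m₁ ⊢
      linarith [show kernelDiff H s t u ^ 2 ≤ g₁ u from
        kernelDiff_sq_le_of_le hH₀ hH₁ ht.le hs0 c1]
    rcases lt_or_ge u (-(s / 2)) with c2 | c2
    · rw [indicator_of_mem (show u ∈ Ico (-s) (-(s / 2)) from ⟨c1.le, c2⟩)] at m₂ ⊢
      linarith [show kernelDiff H s t u ^ 2 ≤ g₂ u from
        kernelDiff_sq_le_left hH₀ hH₁ ht.le hts c1 hs0 c2]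
    rcases lt_or_ge u 0 with c3 | c3
    · rw [indicator_of_mem (show u ∈ Ico (-(s / 2)) 0 from ⟨c2, c3⟩)] at m₃ ⊢
      linarith [show kernelDiff H s t u ^ 2 ≤ g₃ u from
        kernelDiff_sq_le_right hH₀ hH₁ ht.le hs0 c2 c3]
    rcases lt_or_ge u t with c4 | c4
    · rw [indicator_of_mem (show u ∈ Ico 0 t from ⟨c3, c4⟩)] at m₄ ⊢
      linarith [show kernelDiff H s t u ^ 2 ≤ g₄ u from
        kernelDiff_sq_le_of_nonneg hH₀ hC hC₀ ht hts c3 c4]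
    · rw [kernelDiff_of_ge hH₀ ht.le c4]
      linarith
  have j₁ := i₁.integrable_indicator measurableSet_Iic
  have j₂ := i₂.integrable_indicator measurableSet_Ico
  have j₃ := i₃.integrable_indicator measurableSet_Ico
  have j₄ := i₄.integrable_indicator measurableSet_Ico
  have hfin := integral_mono (memLp_kernelDiff hH₀ hH₁ s t).integrable_sq
    (((j₁.add j₂).add j₃).add j₄) key
  refine hfin.trans ?_
  rw [integral_add' ((j₁.add j₂).add j₃) j₄, integral_add' (j₁.add j₂) j₃, integral_add' j₁ j₂,
    integral_indicator measurableSet_Iic, integral_indicator measurableSet_Ico,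
    integral_indicator measurableSet_Ico, integral_indicator measurableSet_Ico]
  have : 0 < s ^ (2 * H - 2) := by positivity
  simp only [add_mul, one_mul]
  linarith

theorem kernelDiff_zero (H s u : ℝ) : kernelDiff H s 0 u = 0 := by
  simp [kernelDiff, fKernel_zero]

/-- Going back by `t` from time `0` is, up to sign and translation, going forward by `t` from time
`-t`, where the elapsed past is `s - t`. -/
theorem kernelDiff_neg_time (H s t u : ℝ) :
    kernelDiff H s (-t) u = -kernelDiff H (s - t) t (u + t) := by
  simp only [kernelDiff, fKernel_neg]
  rw [show t + (s - t) = s by ring, show u + t + (s - t) = u + s by ring,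
    show -t + s = s - t by ring]
  ring

theorem exists_integral_kernelDiff_sq_le {H : ℝ} (hH₀ : 0 < H) (hH₁ : H < 1) (t : ℝ) :
    ∃ S, 0 < S ∧ ∃ C, 0 < C ∧ ∀ s, S < s →
      ∫ u, kernelDiff H s t u ^ 2 ≤ C * s ^ (2 * H - 2) := by
  rcases lt_trichotomy t 0 with h | rfl | h
  · obtain ⟨C, hC, hb⟩ := exists_integral_kernelDiff_sq_le_of_pos hH₀ hH₁ (neg_pos.2 h)
    -- For `s > 2 |t| + 2` the shifted parameter satisfies `s - |t| ≥ s / 2`; since the exponent is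
    -- negative this costs the factor `2⁻¹ ^ (2 * H - 2)`.
    refine ⟨2 * |t| + 2, by positivity,
      C * (2⁻¹ : ℝ) ^ (2 * H - 2), by positivity, fun s hs => ?_⟩
    rw [abs_of_neg h] at hs
    have h1 := hb (s - -t) (by linarith) (by linarith)
    have h2 : ∀ u, kernelDiff H s t u ^ 2 = kernelDiff H (s - -t) (-t) (u + -t) ^ 2 := fun u => by
      have := kernelDiff_neg_time H s (-t) u
      rw [neg_neg] at this
      rw [this, neg_sq]
    simp_rw [h2]
    rw [integral_add_right_eq_self (fun u => kernelDiff H (s - -t) (-t) u ^ 2) (-t)]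
    refine h1.trans ?_
    rw [mul_assoc, ← Real.mul_rpow (by norm_num) (by linarith)]
    exact mul_le_mul_of_nonneg_left
      (Real.rpow_le_rpow_of_nonpos (by linarith) (by linarith) (by linarith)) hC.le
  · refine ⟨1, one_pos, 1, one_pos, fun s hs => ?_⟩
    simp only [kernelDiff_zero]
    have : 0 < s := by linarith
    simp
    positivity
  · obtain ⟨C, hC, hb⟩ := exists_integral_kernelDiff_sq_le_of_pos hH₀ hH₁ h
    refine ⟨t + 1, by linarith, C, hC, fun s hs => ?_⟩
    exact hb s (by linarith) (by linarith)

end KernelDifferenceIntegral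

/-! ### Tools on second moments and additive functions. -/

section SecondMoments

open MeasureTheory ProbabilityTheory Filter

variable {Ω : Type*} [MeasurableSpace Ω] {P : Measure Ω}

theorem eLpNorm_two_eq_ofReal_sqrt {f : Ω → ℝ} (hf : MemLp f 2 P) :
    eLpNorm f 2 P = ENNReal.ofReal √(∫ ω, f ω ^ 2 ∂P) := by
  rw [hf.eLpNorm_eq_integral_rpow_norm two_ne_zero ENNReal.ofNat_ne_top, Real.sqrt_eq_rpow]
  norm_num

/-- Both modes of convergence imply convergence in measure, whose limit is unique. -/
theorem ae_eq_of_tendsto_integral_sq_sub [IsFiniteMeasure P] {f : ℕ → Ω → ℝ} {g h : Ω → ℝ}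
    (hf : ∀ n, MemLp (f n) 2 P) (hg : MemLp g 2 P)
    (hfg : Tendsto (fun n => ∫ ω, (f n ω - g ω) ^ 2 ∂P) atTop (𝓝 0))
    (hfh : ∀ᵐ ω ∂P, Tendsto (fun n => f n ω) atTop (𝓝 (h ω))) : g =ᵐ[P] h := by
  have h1 : TendstoInMeasure P f atTop h :=
    tendstoInMeasure_of_tendsto_ae (fun n => (hf n).1) hfh
  have h2 : TendstoInMeasure P f atTop g := by
    refine tendstoInMeasure_of_tendsto_eLpNorm two_ne_zero (fun n => (hf n).1) hg.1 ?_
    have e : ∀ n, eLpNorm (f n - g) 2 P = ENNReal.ofReal √(∫ ω, (f n ω - g ω) ^ 2 ∂P) :=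
      fun n => eLpNorm_two_eq_ofReal_sqrt ((hf n).sub hg)
    simp_rw [e]
    simpa using ENNReal.tendsto_ofReal ((Real.continuous_sqrt.tendsto 0).comp hfg)
  exact tendstoInMeasure_ae_unique h2 h1

/-- Under the product law, Fubini gives some constant `y` for which `X + y` is square integrable. -/
theorem memLp_of_indepFun_of_memLp_add [IsProbabilityMeasure P] {X Y : Ω → ℝ}
    (hX : Measurable X) (hY : Measurable Y) (hXY : IndepFun X Y P)
    (h : MemLp (fun ω => X ω + Y ω) 2 P) : MemLp X 2 P := by
  have hXY' : Measurable fun ω => (X ω, Y ω) := hX.prodMk hY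
  have hmap := (indepFun_iff_map_prod_eq_prod_map_map hX.aemeasurable hY.aemeasurable).1 hXY
  have : IsProbabilityMeasure (P.map X) := Measure.isProbabilityMeasure_map hX.aemeasurable
  have : IsProbabilityMeasure (P.map Y) := Measure.isProbabilityMeasure_map hY.aemeasurable
  have h1 : MemLp (fun p : ℝ × ℝ => p.1 + p.2) 2 ((P.map X).prod (P.map Y)) := by
    rw [← hmap, memLp_map_measure_iff (by fun_prop) hXY'.aemeasurable]
    exact h
  obtain ⟨y, hy⟩ := h1.integrable_sq.prod_left_ae.exists
  have h2 : MemLp (fun x : ℝ => x + y) 2 (P.map X) :=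
    (memLp_two_iff_integrable_sq (by fun_prop)).2 hy
  have h3 : MemLp (fun x : ℝ => x) 2 (P.map X) := by
    refine (h2.sub (memLp_const y)).ae_eq (Eventually.of_forall fun x => ?_)
    simp
  exact (memLp_map_measure_iff (by fun_prop) hX.aemeasurable).1 h3

/-- A nonnegative additive function is monotone, which rules out the wild solutions of Cauchy's
equation. -/
theorem eq_mul_of_map_add_of_nonneg {f : ℝ≥0 → ℝ} (hadd : ∀ s t, f (s + t) = f s + f t)
    (hnn : ∀ t, 0 ≤ f t) (t : ℝ≥0) : f t = t * f 1 := by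
  have h0 : f 0 = 0 := by simpa using hadd 0 0
  let φ : ℝ≥0 →+ ℝ := ⟨⟨f, h0⟩, hadd⟩
  have hmul : ∀ (n : ℕ) x, f (n * x) = n * f x := fun n x => by
    rw [← nsmul_eq_mul, ← nsmul_eq_mul]; exact map_nsmul φ n x
  have hmono : Monotone f := fun x y hxy => by
    obtain ⟨z, rfl⟩ := exists_add_of_le hxy
    rw [hadd]; linarith [hnn z]
  have hnat : ∀ n : ℕ, f n = n * f 1 := fun n => by simpa using hmul n 1
  -- Both `n * f t` and `n * t * f 1` lie between `⌊n t⌋ * f 1` and `(⌊n t⌋ + 1) * f 1`.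
  have key : ∀ n : ℕ, n * |f t - t * f 1| ≤ f 1 := by
    intro n
    have l1 := hmono (Nat.floor_le (zero_le (a := (n * t : ℝ≥0))))
    have l2 := hmono (Nat.lt_floor_add_one (n * t : ℝ≥0)).le
    rw [show ((⌊n * t⌋₊ : ℝ≥0) + 1) = ((⌊n * t⌋₊ + 1 : ℕ) : ℝ≥0) by push_cast; rfl] at l2
    rw [hnat, hmul] at l1 l2
    have l3 : ((⌊n * t⌋₊ : ℝ≥0) : ℝ) ≤ (n * t : ℝ≥0) :=
      NNReal.coe_le_coe.2 (Nat.floor_le (zero_le (a := (n * t : ℝ≥0))))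
    have l4 : ((n * t : ℝ≥0) : ℝ) ≤ ((⌊n * t⌋₊ + 1 : ℝ≥0) : ℝ) :=
      NNReal.coe_le_coe.2 (Nat.lt_floor_add_one (n * t : ℝ≥0)).le
    push_cast at l1 l2 l3 l4
    rw [← abs_of_nonneg (Nat.cast_nonneg n : (0 : ℝ) ≤ n), ← abs_mul, abs_le]
    have := hnn 1
    constructor <;> nlinarith
  by_contra hne
  have hpos : 0 < |f t - t * f 1| := abs_pos.2 (sub_ne_zero.2 hne)
  obtain ⟨n, hn⟩ := exists_nat_gt (f 1 / |f t - t * f 1|)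
  rw [div_lt_iff₀ hpos] at hn
  linarith [key n]

theorem integral_sq_eq_variance {X : Ω → ℝ} [IsProbabilityMeasure P]
    (hX : AEMeasurable X P) (h0 : ∫ ω, X ω ∂P = 0) : ∫ ω, X ω ^ 2 ∂P = Var[X; P] := by
  rw [variance_of_integral_eq_zero hX h0]

end SecondMoments

/-! ### Means and variances of Lévy increments. -/

section LevyMoments

open MeasureTheory ProbabilityTheory Filter

variable {Ω : Type*} [MeasurableSpace Ω] {P : Measure Ω} {X : ℝ≥0 → Ω → ℝ}

namespace IsLevy

theorem indepFun_increment (hX : IsLevy X P) (s t : ℝ≥0) :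
    IndepFun (X s) (fun ω => X (s + t) ω - X s ω) P :=
  hX.indep.indepFun_eval_sub zero_le le_self_add hX.zero

variable [IsProbabilityMeasure P]

/-- Stationarity moves square integrability up to all positive integers; independence of the later
increment moves it down to any smaller time. -/
theorem memLp (hX : IsLevy X P) (h1 : MemLp (X 1) 2 P) (t : ℝ≥0) : MemLp (X t) 2 P := by
  have hdown : ∀ s t, MemLp (X (s + t)) 2 P → MemLp (X s) 2 P := fun s t h =>
    memLp_of_indepFun_of_memLp_add (hX.measurable s)
      ((hX.measurable _).sub (hX.measurable s)) (hX.indepFun_increment s t) (by simpa using h)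
  have hnat : ∀ n : ℕ, MemLp (X (n + 1)) 2 P := by
    intro n
    induction n with
    | zero => simpa using h1
    | succ n ih =>
      have h := ((hX.stationary (n + 1) 1).symm.memLp_snd h1).add ih
      refine h.ae_eq (Eventually.of_forall fun ω => ?_)
      simp
  obtain ⟨n, hn⟩ := exists_nat_ge t
  obtain ⟨r, hr⟩ := exists_add_of_le (hn.trans (le_add_of_nonneg_right (zero_le (a := (1 : ℝ≥0)))))
  exact hdown t r (hr ▸ hnat n)

theorem integral_add (hX : IsLevy X P) (h1 : MemLp (X 1) 2 P) (s t : ℝ≥0) :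
    ∫ ω, X (s + t) ω ∂P = ∫ ω, X s ω ∂P + ∫ ω, X t ω ∂P := by
  rw [← (hX.stationary s t).integral_eq, integral_sub
    ((hX.memLp h1 _).integrable one_le_two) ((hX.memLp h1 _).integrable one_le_two)]
  ring

theorem variance_eq (hX : IsLevy X P) (h1 : MemLp (X 1) 2 P) (t : ℝ≥0) :
    Var[X t; P] = t * Var[X 1; P] := by
  refine eq_mul_of_map_add_of_nonneg (f := fun t => Var[X t; P]) (fun s t => ?_)
    (fun t => variance_nonneg _ _) t
  have h := (hX.indepFun_increment s t).variance_add (hX.memLp h1 s)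
    ((hX.memLp h1 (s + t)).sub (hX.memLp h1 s))
  rw [add_sub_cancel] at h
  have hv : Var[X (s + t) - X s; P] = Var[X t; P] := (hX.stationary s t).variance_eq
  rw [hv] at h
  exact h

/-- The mean is additive but has no sign, so the regularity comes from the paths. For small `h n`
differing from `t` by a rational, `X (h n)` has mean `m t` and variance tending to `0`, hence tends
to `m t` in `L²`; right continuity at `0` forces the limit `0`. -/
theorem integral_eq_zero (hX : IsLevy X P) (h1 : MemLp (X 1) 2 P) (h0 : ∫ ω, X 1 ω ∂P = 0)
    (t : ℝ≥0) : ∫ ω, X t ω ∂P = 0 := by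
  set m : ℝ≥0 → ℝ := fun t => ∫ ω, X t ω ∂P with hm
  have hadd : ∀ s t, m (s + t) = m s + m t := hX.integral_add h1
  let φ : ℝ≥0 →+ ℝ := ⟨⟨m, by simpa using hadd 0 0⟩, hadd⟩
  have hmul : ∀ (n : ℕ) x, m (n * x) = n * m x := fun n x => by
    rw [← nsmul_eq_mul, ← nsmul_eq_mul]; exact map_nsmul φ n x
  have hrat : ∀ k n : ℕ, m (k / (n + 1)) = 0 := fun k n => by
    have e := hmul (n + 1) (k / (n + 1))
    rw [show ((n + 1 : ℕ) : ℝ≥0) * (k / (n + 1)) = k * 1 by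
      push_cast; field_simp, hmul, show m 1 = 0 from h0, mul_zero] at e
    exact (mul_eq_zero.1 e.symm).resolve_left (by positivity)
  set q : ℕ → ℝ≥0 := fun n => (⌊(n + 1 : ℝ≥0) * t⌋₊ : ℝ≥0) / (n + 1) with hq
  have hqt : ∀ n, q n ≤ t := fun n => by
    rw [hq]; simp only
    rw [div_le_iff₀ (by positivity), mul_comm t]
    exact Nat.floor_le zero_le
  set h : ℕ → ℝ≥0 := fun n => t - q n with hh
  have hmh : ∀ n, m (h n) = m t := fun n => by
    have := hadd (h n) (q n)
    rw [hh, tsub_add_cancel_of_le (hqt n), hrat, add_zero] at this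
    exact this.symm
  have hle : ∀ n, h n ≤ 1 / (n + 1) := fun n => by
    rw [hh]; simp only
    rw [tsub_le_iff_right, hq, ← add_div, le_div_iff₀ (by positivity), mul_comm t, add_comm (1 : ℝ≥0)]
    exact (Nat.lt_floor_add_one _).le
  have hlim : Tendsto h atTop (𝓝 0) := by
    have : Tendsto (fun n : ℕ => (1 : ℝ≥0) / (n + 1)) atTop (𝓝 0) := by
      rw [← NNReal.tendsto_coe]
      simpa using tendsto_one_div_add_atTop_nhds_zero_nat (𝕜 := ℝ)
    exact tendsto_of_tendsto_of_tendsto_of_le_of_le tendsto_const_nhds this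
      (fun _ => zero_le) hle
  have hae : (fun _ => m t) =ᵐ[P] fun _ : Ω => (0 : ℝ) := by
    refine ae_eq_of_tendsto_integral_sq_sub (f := fun n => X (h n)) (fun n => hX.memLp h1 _)
      (memLp_const _) ?_ ?_
    · have e : ∀ n, ∫ ω, (X (h n) ω - m t) ^ 2 ∂P = h n * Var[X 1; P] := fun n => by
        rw [← hX.variance_eq h1, variance_eq_integral (hX.measurable _).aemeasurable, ← hmh n]
      simp_rw [e]
      simpa using ((NNReal.tendsto_coe.2 hlim).mul_const (Var[X 1; P]))
    · filter_upwards [hX.zero, hX.cadlag] with ω hω0 hω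
      have h := (hω 0).1
      rw [ContinuousWithinAt, hω0] at h
      refine h.comp (tendsto_nhdsWithin_iff.2 ⟨hlim, Eventually.of_forall fun n => ?_⟩)
      exact Set.mem_Ici.2 zero_le
  obtain ⟨ω, hω⟩ := hae.exists
  exact hω

theorem integral_sq (hX : IsLevy X P) (h1 : MemLp (X 1) 2 P) (h0 : ∫ ω, X 1 ω ∂P = 0)
    (t : ℝ≥0) : ∫ ω, X t ω ^ 2 ∂P = t * ∫ ω, X 1 ω ^ 2 ∂P := by
  rw [integral_sq_eq_variance (hX.measurable t).aemeasurable (hX.integral_eq_zero h1 h0 t),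
    integral_sq_eq_variance (hX.measurable 1).aemeasurable h0, hX.variance_eq h1]

theorem integral_sq_increment (hX : IsLevy X P) (h1 : MemLp (X 1) 2 P)
    (h0 : ∫ ω, X 1 ω ∂P = 0) (s t : ℝ≥0) :
    ∫ ω, (X t ω - X s ω) ^ 2 ∂P = |(t : ℝ) - s| * ∫ ω, X 1 ω ^ 2 ∂P := by
  wlog hst : s ≤ t generalizing s t
  · have := this t s (le_of_not_ge hst)
    rw [abs_sub_comm] at this
    simpa only [sub_sq_comm] using this
  obtain ⟨r, rfl⟩ := exists_add_of_le hst
  have := ((hX.stationary s r).comp (measurable_id.pow_const 2)).integral_eq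
  simp only [Function.comp_def, id] at this
  rw [this, hX.integral_sq h1 h0]
  simp

/-- There are almost surely no jumps at a fixed time: along `u n ↑ t` the paths tend to the left
limit, while the variance formula gives `L²` convergence to `X t`. -/
theorem leftLim_ae_eq (hX : IsLevy X P) (h1 : MemLp (X 1) 2 P) (h0 : ∫ ω, X 1 ω ∂P = 0)
    {t : ℝ≥0} (ht : 0 < t) :
    (fun ω => Function.leftLim (fun u => X u ω) t) =ᵐ[P] X t := by
  have : (𝓝[<] t).NeBot := nhdsLT_neBot_of_exists_lt ⟨0, ht⟩
  obtain ⟨u, hu⟩ := exists_seq_tendsto (𝓝[<] t)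
  refine (ae_eq_of_tendsto_integral_sq_sub (f := fun n => X (u n)) (fun n => hX.memLp h1 _)
    (hX.memLp h1 t) ?_ ?_).symm
  · simp_rw [hX.integral_sq_increment h1 h0]
    have : Tendsto (fun n => (u n : ℝ)) atTop (𝓝 (t : ℝ)) :=
      NNReal.tendsto_coe.2 (hu.mono_right nhdsWithin_le_nhds)
    simpa using ((this.sub_const (t : ℝ)).abs.mul_const (∫ ω, X 1 ω ^ 2 ∂P))
  · filter_upwards [hX.cadlag] with ω hω
    exact (tendsto_leftLim_of_tendsto (hω t).2).comp hu

end IsLevy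

variable [IsProbabilityMeasure P]

/-- For times of opposite sign the increment is almost surely a sum of independent centred values of
`L₁` and `L₂`, whose variances add. The left limits in the negative half are removed by
`leftLim_ae_eq`. -/
theorem IsTwoSidedLevy.exists_integral_sq_increment {L : ℝ → Ω → ℝ} (hL : IsTwoSidedLevy L P)
    (hL2 : MemLp (L 1) 2 P) (hL0 : ∫ ω, L 1 ω ∂P = 0) :
    (∀ t, MemLp (L t) 2 P) ∧ ∃ v : ℝ, 0 ≤ v ∧
      ∀ s t, ∫ ω, (L t ω - L s ω) ^ 2 ∂P = v * |t - s| := by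
  obtain ⟨L₁, L₂, h₁, h₂, hid, hind, hL⟩ := hL
  have e1 : L 1 = L₁ 1 := by ext ω; simp [hL]
  rw [e1] at hL2 hL0
  have hid1 : IdentDistrib (L₁ 1) (L₂ 1) P P := hid.comp (measurable_pi_apply 1)
  have hM2 : MemLp (L₂ 1) 2 P := hid1.memLp_snd hL2
  have hM0 : ∫ ω, L₂ 1 ω ∂P = 0 := hid1.integral_eq ▸ hL0
  have hv : ∫ ω, L₂ 1 ω ^ 2 ∂P = ∫ ω, L₁ 1 ω ^ 2 ∂P :=
    ((hid1.comp (measurable_id.pow_const 2)).integral_eq).symm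
  have hpos : ∀ t, 0 ≤ t → L t =ᵐ[P] L₁ t.toNNReal := fun t ht =>
    Eventually.of_forall fun ω => by rw [hL, if_pos ht]
  have hneg : ∀ t, t < 0 → L t =ᵐ[P] fun ω => -L₂ (-t).toNNReal ω := fun t ht => by
    filter_upwards [h₂.leftLim_ae_eq hM2 hM0 (t := (-t).toNNReal) (by simpa using ht)] with ω hω
    rw [hL, if_neg ht.not_ge, hω]
  refine ⟨fun t => ?_, ∫ ω, L₁ 1 ω ^ 2 ∂P, integral_nonneg fun _ => sq_nonneg _, fun s t => ?_⟩
  · rcases le_or_gt 0 t with ht | ht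
    · exact (h₁.memLp hL2 _).ae_eq (hpos t ht).symm
    · exact (h₂.memLp hM2 _).neg.ae_eq (hneg t ht).symm
  wlog hst : s ≤ t generalizing s t
  · have := this t s (le_of_not_ge hst)
    rw [abs_sub_comm] at this
    simpa only [sub_sq_comm] using this
  rcases le_or_gt 0 s with hs | hs
  · have ht := hs.trans hst
    rw [integral_congr_ae (g := fun ω => (L₁ t.toNNReal ω - L₁ s.toNNReal ω) ^ 2) (by
      filter_upwards [hpos t ht, hpos s hs] with ω a b
      rw [a, b]), h₁.integral_sq_increment hL2 hL0, Real.coe_toNNReal _ ht,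
      Real.coe_toNNReal _ hs, mul_comm]
  rcases le_or_gt 0 t with ht | ht
  · rw [integral_congr_ae (g := fun ω => (L₁ t.toNNReal + L₂ (-s).toNNReal) ω ^ 2) (by
      filter_upwards [hpos t ht, hneg s hs] with ω a b
      rw [a, b, sub_neg_eq_add, Pi.add_apply])]
    have i1 := (h₁.memLp hL2 t.toNNReal)
    have i2 := (h₂.memLp hM2 (-s).toNNReal)
    have z1 := h₁.integral_eq_zero hL2 hL0 t.toNNReal
    have z2 := h₂.integral_eq_zero hM2 hM0 (-s).toNNReal
    have hi : IndepFun (L₁ t.toNNReal) (L₂ (-s).toNNReal) P :=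
      hind.comp (measurable_pi_apply t.toNNReal) (measurable_pi_apply (-s).toNNReal)
    rw [integral_sq_eq_variance (i1.add i2).1.aemeasurable (by
        rw [integral_add' (i1.integrable one_le_two) (i2.integrable one_le_two), z1, z2, add_zero]),
      hi.variance_add i1 i2, ← integral_sq_eq_variance i1.1.aemeasurable z1,
      ← integral_sq_eq_variance i2.1.aemeasurable z2, h₁.integral_sq hL2 hL0,
      h₂.integral_sq hM2 hM0, hv, Real.coe_toNNReal _ ht, Real.coe_toNNReal _ (by linarith),
      abs_of_nonneg (by linarith)]
    ring
  · rw [integral_congr_ae (g := fun ω => (L₂ (-s).toNNReal ω - L₂ (-t).toNNReal ω) ^ 2) (by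
      filter_upwards [hneg t ht, hneg s hs] with ω a b
      rw [a, b]; ring), h₂.integral_sq_increment hM2 hM0, Real.coe_toNNReal _ (by linarith),
      Real.coe_toNNReal _ (by linarith), hv, mul_comm]
    congr 2
    ring

end LevyMoments

/-! ### Proportional Gram matrices give proportional norms. -/

section Gram

open scoped RealInnerProductSpace

variable {J E F : Type*} [NormedAddCommGroup E] [InnerProductSpace ℝ E]
  [NormedAddCommGroup F] [InnerProductSpace ℝ F]

theorem real_inner_sub_sub (x y z w : E) :
    ⟪x - y, z - w⟫ = (‖x - w‖ ^ 2 + ‖y - z‖ ^ 2 - ‖x - z‖ ^ 2 - ‖y - w‖ ^ 2) / 2 := by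
  simp only [norm_sub_sq_real, inner_sub_left, inner_sub_right]
  ring

theorem norm_sq_linearCombination_of_inner_eq {x : J → E} {y : J → F} {v : ℝ}
    (h : ∀ i j, ⟪x i, x j⟫ = v * ⟪y i, y j⟫) (f : J →₀ ℝ) :
    ‖Finsupp.linearCombination ℝ x f‖ ^ 2 = v * ‖Finsupp.linearCombination ℝ y f‖ ^ 2 := by
  simp only [← real_inner_self_eq_norm_sq, Finsupp.linearCombination_apply, Finsupp.sum,
    sum_inner, inner_sum, real_inner_smul_left, real_inner_smul_right, h, Finset.mul_sum]
  refine Finset.sum_congr rfl fun i _ => Finset.sum_congr rfl fun j _ => ?_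
  ring

end Gram

/-! ### Interval indicators in `L²(ℝ)` and the density of step functions. -/

section StepFunctions

open MeasureTheory Filter
open scoped RealInnerProductSpace

variable {Ω : Type*} [MeasurableSpace Ω] {P : Measure Ω}

theorem norm_toLp_sq {α : Type*} [MeasurableSpace α] {μ : Measure α} {f : α → ℝ}
    (hf : MemLp f 2 μ) : ‖hf.toLp f‖ ^ 2 = ∫ x, f x ^ 2 ∂μ := by
  rw [Lp.norm_toLp, eLpNorm_two_eq_ofReal_sqrt hf, ENNReal.toReal_ofReal (Real.sqrt_nonneg _),
    Real.sq_sqrt (integral_nonneg fun _ => sq_nonneg _)]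

theorem coeFn_finsetSum_ae_eq {ι α : Type*} [MeasurableSpace α] {μ : Measure α} (s : Finset ι)
    {F : ι → Lp ℝ 2 μ} {f : ι → α → ℝ} (h : ∀ i, F i =ᵐ[μ] f i) :
    ⇑(∑ i ∈ s, F i) =ᵐ[μ] fun x => ∑ i ∈ s, f i x := by
  classical
  induction s using Finset.induction_on with
  | empty => simpa using! Lp.coeFn_zero ℝ 2 μ
  | insert i s hi ih =>
    rw [Finset.sum_insert hi]
    filter_upwards [Lp.coeFn_add (F i) (∑ i ∈ s, F i), ih, h i] with x h1 h2 h3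
    rw [h1, Pi.add_apply, h2, h3, Finset.sum_insert hi]

/-- Pairs of left and right endpoints of intervals. -/
abbrev Endpoints : Type := {p : ℝ × ℝ // p.1 ≤ p.2}

/-- The indicator of a half-open interval as an element of `L²(ℝ)`. -/
noncomputable def intervalVec (p : Endpoints) : Lp ℝ 2 (volume : Measure ℝ) :=
  indicatorConstLp 2 (measurableSet_Ioc (a := p.1.1) (b := p.1.2)) measure_Ioc_lt_top.ne 1

/-- The overlap length is written through distances of endpoints, the form that polarization
produces for increments of the process. -/
theorem inner_intervalVec (p q : Endpoints) : ⟪intervalVec p, intervalVec q⟫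
    = (|q.1.2 - p.1.1| + |q.1.1 - p.1.2| - |q.1.2 - p.1.2| - |q.1.1 - p.1.1|) / 2 := by
  obtain ⟨⟨a, b⟩, hab⟩ := p
  obtain ⟨⟨c, d⟩, hcd⟩ := q
  simp only at hab hcd ⊢
  rw [intervalVec, intervalVec, L2.real_inner_indicatorConstLp_one_indicatorConstLp_one
      measurableSet_Ioc measurableSet_Ioc measure_Ioc_lt_top.ne measure_Ioc_lt_top.ne,
    Set.Ioc_inter_Ioc, Measure.real, Real.volume_Ioc, ENNReal.toReal_ofReal']
  simp only [max_def, min_def, abs]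
  grind

/-- A function orthogonal to all intervals has vanishing primitive, so it is zero almost everywhere
by Lebesgue differentiation. -/
theorem span_intervalVec_orthogonal : (Submodule.span ℝ (Set.range intervalVec))ᗮ = ⊥ := by
  rw [Submodule.eq_bot_iff]
  intro g hg
  have hint : ∀ a b : ℝ, a ≤ b → ∫ x in Set.Ioc a b, g x = 0 := fun a b hab => by
    have := (Submodule.mem_orthogonal _ _).1 hg (intervalVec ⟨(a, b), hab⟩)
      (Submodule.subset_span ⟨_, rfl⟩)
    rwa [intervalVec, L2.inner_indicatorConstLp_one] at this
  have hzero : ∀ x, ∫ t in (0 : ℝ)..x, g t = 0 := fun x => by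
    rcases le_total 0 x with h | h
    · rw [intervalIntegral.integral_of_le h, hint 0 x h]
    · rw [intervalIntegral.integral_of_ge h, hint x 0 h, neg_zero]
  have hloc : LocallyIntegrable g volume := (Lp.memLp g).locallyIntegrable one_le_two
  refine Lp.ext ?_
  filter_upwards [_root_.LocallyIntegrable.ae_hasDerivAt_integral hloc, Lp.coeFn_zero ℝ 2 (volume : Measure ℝ)] with x hx h0
  have h1 := hx 0
  simp only [hzero] at h1
  rw [h0, Pi.zero_apply]
  exact h1.unique (hasDerivAt_const x 0)

/-- A step function as a finite linear combination of intervals. -/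
noncomputable def StepFun.toFinsupp (φ : StepFun) : Endpoints →₀ ℝ :=
  ∑ i, Finsupp.single ⟨(φ.left i, φ.right i), φ.left_le_right i⟩ (φ.coef i)

theorem StepFun.linearCombination_toFinsupp {E : Type*} [AddCommGroup E] [Module ℝ E]
    (x : Endpoints → E) (φ : StepFun) : Finsupp.linearCombination ℝ x φ.toFinsupp
      = ∑ i, φ.coef i • x ⟨(φ.left i, φ.right i), φ.left_le_right i⟩ := by
  simp [StepFun.toFinsupp, map_sum]

theorem StepFun.memLp_eval (φ : StepFun) : MemLp φ.eval 2 volume :=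
  memLp_finsetSum _ fun _ _ =>
    (memLp_indicator_const 2 measurableSet_Ioc (1 : ℝ) (Or.inr measure_Ioc_lt_top.ne)).const_mul _

theorem StepFun.linearCombination_intervalVec (φ : StepFun) :
    Finsupp.linearCombination ℝ intervalVec φ.toFinsupp = φ.memLp_eval.toLp φ.eval := by
  rw [StepFun.linearCombination_toFinsupp]
  refine Lp.ext ((coeFn_finsetSum_ae_eq _ (f := fun i x =>
    φ.coef i * (Set.Ioc (φ.left i) (φ.right i)).indicator 1 x) fun i => ?_).trans
      φ.memLp_eval.coeFn_toLp.symm)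
  filter_upwards [Lp.coeFn_smul (φ.coef i)
    (intervalVec ⟨(φ.left i, φ.right i), φ.left_le_right i⟩),
    indicatorConstLp_coeFn (p := 2) (c := (1 : ℝ)) (hs := measurableSet_Ioc)
      (hμs := (measure_Ioc_lt_top (μ := volume) (a := φ.left i) (b := φ.right i)).ne)]
    with x h1 h2
  rw [h1, Pi.smul_apply, smul_eq_mul, intervalVec, h2]
  rfl

theorem StepFun.exists_tendsto_toLp {g : ℝ → ℝ} (hg : MemLp g 2 volume) :
    ∃ φ : ℕ → StepFun, Tendsto (fun n => (φ n).memLp_eval.toLp (φ n).eval) atTop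
      (𝓝 (hg.toLp g)) := by
  have hmem : hg.toLp g ∈ closure (Submodule.span ℝ (Set.range intervalVec) : Set (Lp ℝ 2 volume)) := by
    rw [← Submodule.topologicalClosure_coe,
      Submodule.topologicalClosure_eq_top_iff.2 span_intervalVec_orthogonal]
    exact Set.mem_univ _
  obtain ⟨u, hu, hlim⟩ := mem_closure_iff_seq_limit.1 hmem
  have hφ : ∀ n, ∃ φ : StepFun, φ.memLp_eval.toLp φ.eval = u n := by
    intro n
    obtain ⟨k, c, y, hy⟩ := Submodule.mem_span_set'.1 (hu n)
    choose p hp using fun i => (y i).2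
    refine ⟨⟨k, c, fun i => (p i).1.1, fun i => (p i).1.2, fun i => (p i).2⟩, ?_⟩
    rw [← StepFun.linearCombination_intervalVec, StepFun.linearCombination_toFinsupp, ← hy]
    exact Finset.sum_congr rfl fun i _ => by rw [← hp]
  choose φ hφ using hφ
  exact ⟨φ, by simpa only [hφ] using hlim⟩

end StepFunctions

/-! ### The isometry for the stochastic integral. -/

section Isometry

open MeasureTheory Filter
open scoped RealInnerProductSpace

variable {Ω : Type*} [MeasurableSpace Ω] {P : Measure Ω} {M : ℝ → Ω → ℝ}

/-- The increment of a square integrable process over an interval as an element of `L²(P)`. -/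
noncomputable def incrementVec (hM : ∀ t, MemLp (M t) 2 P) (p : Endpoints) : Lp ℝ 2 P :=
  (hM p.1.2).toLp (M p.1.2) - (hM p.1.1).toLp (M p.1.1)

theorem inner_incrementVec (hM : ∀ t, MemLp (M t) 2 P) {v : ℝ}
    (hv : ∀ s t, ∫ ω, (M t ω - M s ω) ^ 2 ∂P = v * |t - s|) (p q : Endpoints) :
    ⟪incrementVec hM p, incrementVec hM q⟫ = v * ⟪intervalVec p, intervalVec q⟫ := by
  have h : ∀ s t, ‖(hM t).toLp (M t) - (hM s).toLp (M s)‖ ^ 2 = v * |t - s| := fun s t => by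
    rw [← MemLp.toLp_sub, norm_toLp_sq, ← hv]
    rfl
  rw [incrementVec, incrementVec, real_inner_sub_sub, h, h, h, h, inner_intervalVec,
    abs_sub_comm q.1.2 p.1.1, abs_sub_comm q.1.1 p.1.2, abs_sub_comm q.1.2 p.1.2,
    abs_sub_comm q.1.1 p.1.1]
  ring

theorem StepFun.memLp_integral (hM : ∀ t, MemLp (M t) 2 P) (φ : StepFun) :
    MemLp (φ.integral M) 2 P :=
  memLp_finsetSum _ fun _ _ => ((hM _).sub (hM _)).const_mul _

theorem StepFun.linearCombination_incrementVec (hM : ∀ t, MemLp (M t) 2 P) (φ : StepFun) :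
    Finsupp.linearCombination ℝ (incrementVec hM) φ.toFinsupp
      = (φ.memLp_integral hM).toLp (φ.integral M) := by
  rw [StepFun.linearCombination_toFinsupp]
  refine Lp.ext ((coeFn_finsetSum_ae_eq _ (f := fun i ω =>
    φ.coef i * (M (φ.right i) ω - M (φ.left i) ω)) fun i => ?_).trans
      (φ.memLp_integral hM).coeFn_toLp.symm)
  filter_upwards [Lp.coeFn_smul (φ.coef i)
    (incrementVec hM ⟨(φ.left i, φ.right i), φ.left_le_right i⟩),
    Lp.coeFn_sub ((hM (φ.right i)).toLp (M (φ.right i))) ((hM (φ.left i)).toLp (M (φ.left i))),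
    (hM (φ.right i)).coeFn_toLp, (hM (φ.left i)).coeFn_toLp] with x h1 h2 h3 h4
  rw [h1, Pi.smul_apply, smul_eq_mul, incrementVec, h2, Pi.sub_apply, h3, h4]

theorem norm_linearCombination_incrementVec (hM : ∀ t, MemLp (M t) 2 P) {v : ℝ} (hv0 : 0 ≤ v)
    (hv : ∀ s t, ∫ ω, (M t ω - M s ω) ^ 2 ∂P = v * |t - s|) (f : Endpoints →₀ ℝ) :
    ‖Finsupp.linearCombination ℝ (incrementVec hM) f‖
      = √v * ‖Finsupp.linearCombination ℝ intervalVec f‖ := by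
  have h := norm_sq_linearCombination_of_inner_eq (inner_incrementVec hM hv) f
  rw [← Real.sqrt_sq (norm_nonneg (Finsupp.linearCombination ℝ (incrementVec hM) f)), h,
    Real.sqrt_mul hv0, Real.sqrt_sq (norm_nonneg _)]

/-- Elementary integrals of approximating step functions are Cauchy by the isometry, and `L²(P)` is
complete. -/
theorem levyIntegrable_of_memLp (hM : ∀ t, MemLp (M t) 2 P) {v : ℝ} (hv0 : 0 ≤ v)
    (hv : ∀ s t, ∫ ω, (M t ω - M s ω) ^ 2 ∂P = v * |t - s|) {g : ℝ → ℝ}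
    (hg : MemLp g 2 volume) : LevyIntegrable P g M := by
  obtain ⟨φ, hφ⟩ := StepFun.exists_tendsto_toLp hg
  have hc : CauchySeq fun n => Finsupp.linearCombination ℝ (incrementVec hM) (φ n).toFinsupp := by
    rw [cauchySeq_iff_tendsto_dist_atTop_0]
    have h := (cauchySeq_iff_tendsto_dist_atTop_0.1 hφ.cauchySeq).const_mul √v
    rw [mul_zero] at h
    refine h.congr fun n => ?_
    rw [dist_eq_norm, dist_eq_norm, ← StepFun.linearCombination_intervalVec,
      ← StepFun.linearCombination_intervalVec, ← map_sub, ← map_sub,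
      norm_linearCombination_incrementVec hM hv0 hv]
  obtain ⟨I, hI⟩ := cauchySeq_tendsto_of_complete hc
  refine ⟨I, hg, Lp.memLp I, φ, ?_, ?_⟩
  · exact (Lp.tendsto_Lp_iff_tendsto_eLpNorm'' _ _ _ _).1 hφ
  · simp only [StepFun.linearCombination_incrementVec] at hI
    rw [← Lp.toLp_coeFn I (Lp.memLp I)] at hI
    exact (Lp.tendsto_Lp_iff_tendsto_eLpNorm'' _ _ _ _).1 hI

theorem IsLevyIntegral.exists_tendsto (hM : ∀ t, MemLp (M t) 2 P) {g : ℝ → ℝ} {I : Ω → ℝ}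
    (h : IsLevyIntegral P g M I) : ∃ f : ℕ → Endpoints →₀ ℝ,
      Tendsto (fun n => Finsupp.linearCombination ℝ intervalVec (f n)) atTop (𝓝 (h.1.toLp g)) ∧
      Tendsto (fun n => Finsupp.linearCombination ℝ (incrementVec hM) (f n)) atTop
        (𝓝 (h.2.1.toLp I)) := by
  obtain ⟨φ, h1, h2⟩ := h.2.2
  refine ⟨fun n => (φ n).toFinsupp, ?_, ?_⟩
  · simp only [StepFun.linearCombination_intervalVec]
    exact (Lp.tendsto_Lp_iff_tendsto_eLpNorm'' _ _ _ _).2 h1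
  · simp only [StepFun.linearCombination_incrementVec]
    exact (Lp.tendsto_Lp_iff_tendsto_eLpNorm'' _ _ _ _).2 h2

/-- The isometry is passed to the limit for the whole combination at once, so neither linearity nor
uniqueness of the integral is needed and any versions are allowed. -/
theorem IsLevyIntegral.integral_sq_sub_sub_mul (hM : ∀ t, MemLp (M t) 2 P) {v : ℝ} (hv0 : 0 ≤ v)
    (hv : ∀ s t, ∫ ω, (M t ω - M s ω) ^ 2 ∂P = v * |t - s|) {g₁ g₂ g₃ : ℝ → ℝ}
    {I₁ I₂ I₃ : Ω → ℝ} (h₁ : IsLevyIntegral P g₁ M I₁) (h₂ : IsLevyIntegral P g₂ M I₂)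
    (h₃ : IsLevyIntegral P g₃ M I₃) (k : ℝ) :
    ∫ ω, (I₁ ω - I₂ ω - k * I₃ ω) ^ 2 ∂P = v * ∫ u, (g₁ u - g₂ u - k * g₃ u) ^ 2 := by
  obtain ⟨f₁, a₁, b₁⟩ := h₁.exists_tendsto hM
  obtain ⟨f₂, a₂, b₂⟩ := h₂.exists_tendsto hM
  obtain ⟨f₃, a₃, b₃⟩ := h₃.exists_tendsto hM
  have hA := ((a₁.sub a₂).sub (a₃.const_smul k)).norm
  have hB := ((b₁.sub b₂).sub (b₃.const_smul k)).norm
  have key := tendsto_nhds_unique hB ((hA.const_mul √v).congr fun n => by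
    rw [← map_smul, ← map_smul, ← map_sub, ← map_sub, ← map_sub, ← map_sub,
      norm_linearCombination_incrementVec hM hv0 hv])
  have key2 := congrArg (· ^ 2) key
  simp only [mul_pow, Real.sq_sqrt hv0, ← MemLp.toLp_sub, ← MemLp.toLp_const_smul,
    norm_toLp_sq] at key2
  simpa using key2

theorem measurable_stepFun_eval (φ : StepFun) : Measurable φ.eval :=
  Finset.measurable_fun_sum _ fun _ _ =>
    (measurable_one.indicator measurableSet_Ioc).const_mul _

/-- Moving all endpoints left by `s` leaves the elementary integrals literally unchanged and
translates the step functions, under which Lebesgue measure is invariant. -/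
theorem IsLevyIntegral.of_shift {g : ℝ → ℝ} {s : ℝ} {L : ℝ → Ω → ℝ} {I : Ω → ℝ}
    (h : IsLevyIntegral P g (shift s L) I) : IsLevyIntegral P (fun u => g (u + s)) L I := by
  have hmp := measurePreserving_add_right (volume : Measure ℝ) s
  obtain ⟨φ, h1, h2⟩ := h.2.2
  refine ⟨h.1.comp_measurePreserving hmp, h.2.1,
    fun n => ⟨(φ n).n, (φ n).coef, fun i => (φ n).left i - s, fun i => (φ n).right i - s,
      fun i => sub_le_sub_right ((φ n).left_le_right i) s⟩, ?_, h2⟩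
  refine h1.congr fun n => ?_
  refine (eLpNorm_comp_measurePreserving
    ((measurable_stepFun_eval (φ n)).aestronglyMeasurable.sub h.1.1) hmp).symm.trans ?_
  congr 1
  ext u
  simp [StepFun.eval, Set.indicator_apply, sub_lt_iff_lt_add, le_sub_iff_add_le]

end Isometry

/-! ### Assembly of the theorem. -/

section Main

open MeasureTheory

variable {Ω : Type*} [MeasurableSpace Ω] {P : Measure Ω}

theorem LevyIntegrable.isLevyIntegral {g : ℝ → ℝ} {L : ℝ → Ω → ℝ} (h : LevyIntegrable P g L) :
    IsLevyIntegral P g L (levyIntegral P g L) := by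
  rw [levyIntegral, dif_pos h]
  exact h.choose_spec

end Main

end FracLevy

theorem mainTheorem4 {Ω : Type*} [MeasurableSpace Ω] (P : MeasureTheory.Measure Ω)
    [MeasureTheory.IsProbabilityMeasure P] (H : ℝ) (hH₀ : 0 < H) (hH₁ : H < 1)
    (L : ℝ → Ω → ℝ) (hL : FracLevy.IsTwoSidedLevy L P)
    (hL2 : MeasureTheory.MemLp (L 1) 2 P) (hL0 : ∫ ω, L 1 ω ∂P = 0) :
    (∀ s : ℝ, 0 < s → ∀ t : ℝ, 0 ≤ t →
      FracLevy.LevyIntegrable P (FracLevy.zKernel H t) (FracLevy.shift s L)) ∧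
    (∀ t : ℝ, FracLevy.LevyIntegrable P (FracLevy.fKernel H t) L) ∧
    ∀ t : ℝ, ∃ S : ℝ, 0 < S ∧ ∃ C : ℝ, 0 < C ∧ ∀ s : ℝ, S < s →
      MeasureTheory.MemLp
        (fun ω => FracLevy.shiftedMG P H L s t ω - FracLevy.limitMvN P H L t ω) 2 P ∧
      ∫ ω, (FracLevy.shiftedMG P H L s t ω - FracLevy.limitMvN P H L t ω) ^ 2 ∂P
        ≤ C * s ^ (2 * H - 2) := by
  obtain ⟨hM, v, hv0, hv⟩ := hL.exists_integral_sq_increment hL2 hL0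
  have hz : ∀ s t, FracLevy.LevyIntegrable P (FracLevy.zKernel H t) (FracLevy.shift s L) :=
    fun s t => FracLevy.levyIntegrable_of_memLp (fun u => hM (u - s)) hv0
      (fun a b => (hv (a - s) (b - s)).trans (by rw [sub_sub_sub_cancel_right]))
      (FracLevy.memLp_zKernel hH₀ hH₁ t)
  have hf : ∀ t, FracLevy.LevyIntegrable P (FracLevy.fKernel H t) L := fun t =>
    FracLevy.levyIntegrable_of_memLp hM hv0 hv (FracLevy.memLp_fKernel hH₀ hH₁ t)
  refine ⟨fun s _ t _ => hz s t, hf, fun t => ?_⟩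
  obtain ⟨S, hS, C, hC, hb⟩ := FracLevy.exists_integral_kernelDiff_sq_le hH₀ hH₁ t
  -- `v + 1` replaces `v`, which is zero for the trivial process, to keep the constant positive.
  refine ⟨S, hS, (v + 1) * C, by positivity, fun s hs => ?_⟩
  have h₁ := (hz s (t + s)).isLevyIntegral
  have h₂ := (hz s s).isLevyIntegral
  have h₃ := (hf t).isLevyIntegral
  refine ⟨(h₁.2.1.sub h₂.2.1).sub (h₃.2.1.const_mul _), ?_⟩
  -- After `of_shift` all three integrals are taken against `L` itself, and their combined kernel is
  -- `kernelDiff H s t`.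
  have h := FracLevy.IsLevyIntegral.integral_sq_sub_sub_mul hM hv0 hv h₁.of_shift h₂.of_shift h₃
    (FracLevy.cMG H / FracLevy.CMvN H)
  refine h.le.trans ?_
  have h0 : 0 ≤ C * s ^ (2 * H - 2) := mul_nonneg hC.le (Real.rpow_nonneg (hS.trans hs).le _)
  calc _ ≤ v * (C * s ^ (2 * H - 2)) := mul_le_mul_of_nonneg_left (hb s hs) hv0
    _ ≤ (v + 1) * C * s ^ (2 * H - 2) := by linarith
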